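/- Let $w_1,\dots,w_n$ be positive integers, $w_0=1$ and $\mu=w_0+w_1+\cdots+w_n$. Let $U=(\mathbb C^*)^n$ with coordinates $u_1,\dots,u_n$, put $u_0=u_1^{-w_1}\cdots u_n^{-w_n}$, and let $$F=u_1+\cdots+u_n+x\,u_0,\qquad x\in\mathbb C^*.$$ Write $\theta=\tau^{-1}$, let $\Omega^p(U)$ be the space of algebraic $p$-forms on $U$, and let $d_u$ be the differential with respect to $u$ only. The Gauss–Manin system of $F$ and its Brieskorn lattice are $$G=\frac{\Omega^n(U)[x,x^{-1},\tau,\tau^{-1}]}{(d_u-\tau\,d_uF)\wedge\Omega^{n-1}(U)[x,x^{-1},\tau,\tau^{-1}]},\qquad G_0=\frac{\Omega^n(U)[x,x^{-1},\theta]}{(\theta\,d_u-d_uF)\wedge\Omega^{n-1}(U)[x,x^{-1},\theta]},$$ with the natural map $G_0\to G$. The connection $\nabla$ on $G$ is given, for $\omega\in\Omega^n(U)[x,x^{-1}]$, by $\nabla_{\partial_\tau}(\omega\tau^i)=i\,\omega\tau^{i-1}-F\omega\tau^i$ and $\nabla_{\partial_x}(\omega\tau^i)=\mathcal L_{\partial_x}(\omega)\tau^i-\frac{\partial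 F}{\partial x}\omega\tau^{i+1}$; thus $\nabla_{\partial_\theta}=-\tau^2\nabla_{\partial_\tau}$. For $f\in\mathbb Q$ let $S_f=\{j\in\{0,\dots,n\}\mid w_jf\in\mathbb Z\}$. Let $c_0\le\cdots\le c_{\mu-1}$ be the fractions $\ell/w_i$ ($0\le\ell\le w_i-1$, $0\le i\le n$) in increasing order, each fraction $f$ being repeated $\#S_f$ times, and put $\alpha_k=k-\mu c_k$. Define $a(k)\in\mathbb N^{n+1}$ by $a(0)=0$ and $a(k+1)=a(k)+\mathbf 1_{i(k)}$, where $i(k)$ is the least $i$ for which $a(k)_i/w_i=\min_j a(k)_j/w_j$. Let $\omega_0^\varphi=\omega_0$ be the class of $\frac{du_1}{u_1}\wedge\cdots\wedge\frac{du_n}{u_n}$ in $G_0$ and, for $1\le k\le\mu-1$, let $$\omega_k^\varphi=\frac{x}{w_1^{a(k)_1}\cdots w_n^{a(k)_n}}\,u_0\,u_1^{a(k)_1}\cdots u_n^{a(k)_n}\,\omega_0 .$$ Let $A_\infty=\mathrm{diag}(\alpha_0,\dots,\alpha_{\mu-1})$, $H=\mathrm{diag}(0,1,\dots,\mu-1)$,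 and let $A_0^\varphi(x)$ be the $\mu\times\mu$ matrix with all entries just below the diagonal equal to $\mu$, with upper right entry $\mu x/(w_1^{w_1}\cdots w_n^{w_n})$, and with all other entries $0$. Then: (1) The classes $\omega_0^\varphi,\dots,\omega_{\mu-1}^\varphi$ form a basis of $G_0$ over $\mathbb C[x,x^{-1},\theta]$, and their images form a basis of $G$ over $\mathbb C[x,x^{-1},\theta,\theta^{-1}]$. (2) In this basis (the $k$-th column giving the image of $\omega_k^\varphi$), the matrix of $\nabla$ is $$\left(\frac{A_0^\varphi(x)}{\theta}+A_\infty\right)\frac{d\theta}{\theta}+\left(-\frac{A_0^\varphi(x)}{\theta}-A_\infty+H\right)\frac{dx}{\mu x}.$$ (3) The $\mathbb C[x,\theta,\theta^{-1}]$-submodule $\mathcal L^\varphi$ of $G$ generated by $\omega_0^\varphi,\dots,\omega_{\mu-1}^\varphi$ is Deligne's canonical extension of $G$ along $x=0$ with residue eigenvalues in $[0,1[$. That is, $\mathcal L^\varphi$ is a finitely generated projective $\mathbb C[x,\theta,\theta^{-1}]$-module, $\mathcal L^\varphi[x^{-1}]=G$, $\mathcal L^\varphi$ is stable under $x\nabla_{\partial_x}$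 and $\nabla_{\partial_\theta}$, and for every $t\in\mathbb C^*$ all eigenvalues of the residue, the endomorphism induced by $x\nabla_{\partial_x}$ on $\mathcal L^\varphi/(x,\theta-t)\mathcal L^\varphi$, lie in $[0,1[$. -/

import Mathlib

open scoped TensorProduct

noncomputable section

namespace BModel

/-! ### Laurent polynomial rings and their derivations -/

/-- For an additive map `χ : M → ℂ`, the derivation of `ℂ[M]` with `t^m ↦ χ(m) t^m`. -/
def euler {M : Type} [AddCommMonoid M] (χ : M →+ ℂ) :
    Derivation ℂ (AddMonoidAlgebra ℂ M) (AddMonoidAlgebra ℂ M) :=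
  Derivation.mk'
    (Finsupp.lsum ℂ (fun m => χ m • AddMonoidAlgebra.lsingle (R := ℂ) (S := ℂ) m) ∘ₗ
      (AddMonoidAlgebra.coeffLinearEquiv ℂ).toLinearMap)
    (by
      have key : ∀ (m : M) (c : ℂ),
          (Finsupp.lsum ℂ (fun m => χ m • AddMonoidAlgebra.lsingle (R := ℂ) (S := ℂ) m) ∘ₗ
            (AddMonoidAlgebra.coeffLinearEquiv ℂ).toLinearMap)
            (AddMonoidAlgebra.single m c : AddMonoidAlgebra ℂ M) =
          AddMonoidAlgebra.single m (χ m * c) := by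
        intro m c
        simp [AddMonoidAlgebra.coeffLinearEquiv, AddMonoidAlgebra.lsingle]
      generalize (Finsupp.lsum ℂ (fun m => χ m • AddMonoidAlgebra.lsingle (R := ℂ) (S := ℂ) m) ∘ₗ
            (AddMonoidAlgebra.coeffLinearEquiv ℂ).toLinearMap) = L at key
      intro a b
      induction a using AddMonoidAlgebra.induction_linear with
      | zero => simp
      | add a a' ha ha' => simp only [add_mul, map_add, ha, ha', smul_eq_mul, mul_add]; ring
      | single m c =>
        induction b using AddMonoidAlgebra.induction_linear with
        | zero => simp
        | add b b' hb hb' => simp only [mul_add, map_add, hb, hb', smul_eq_mul, add_mul]; ring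
        | single m' c' =>
          simp only [AddMonoidAlgebra.single_mul_single, key, smul_eq_mul, map_add]
          rw [add_comm m' m, ← AddMonoidAlgebra.single_add]
          congr 1
          ring)

/-- `ℂ[x, x⁻¹, τ, τ⁻¹] = ℂ[x, x⁻¹, θ, θ⁻¹]`, where `θ = τ⁻¹`; the monomial `x^a θ^b` has
exponent `(a, b)`. -/
abbrev A : Type := AddMonoidAlgebra ℂ (ℤ × ℤ)

/-- The coordinate `x` of `ℂ^*`. -/
def x : A := AddMonoidAlgebra.single (1, 0) 1
/-- `x⁻¹`. -/
def xInv : A := AddMonoidAlgebra.single (-1, 0) 1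
/-- The variable `θ`. -/
def theta : A := AddMonoidAlgebra.single (0, 1) 1
/-- The variable `τ = θ⁻¹`. -/
def tau : A := AddMonoidAlgebra.single (0, -1) 1

theorem theta_mul_tau : theta * tau = 1 := by
  simp [theta, tau, AddMonoidAlgebra.single_mul_single, AddMonoidAlgebra.one_def, ← Prod.zero_eq_mk]

/-- The derivation `∂/∂x` of `ℂ[x, x⁻¹, τ, τ⁻¹]`. -/
def ddx : Derivation ℂ A A :=
  xInv • euler ((Int.castAddHom ℂ).comp (AddMonoidHom.fst ℤ ℤ))
/-- The derivation `∂/∂τ` of `ℂ[x, x⁻¹, τ, τ⁻¹]`, that is `τ⁻¹ (τ ∂/∂τ)`, where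
`τ ∂/∂τ` sends `x^a τ^{-b} = x^a θ^b` to `-b x^a τ^{-b}`. -/
def ddtau : Derivation ℂ A A :=
  theta • euler (-((Int.castAddHom ℂ).comp (AddMonoidHom.snd ℤ ℤ)))

theorem euler_single {M : Type} [AddCommMonoid M] (χ : M →+ ℂ) (m : M) (c : ℂ) :
    euler χ (AddMonoidAlgebra.single m c) = AddMonoidAlgebra.single m (χ m * c) := by
  simp [euler, AddMonoidAlgebra.coeffLinearEquiv, AddMonoidAlgebra.lsingle]

theorem ddx_x : ddx x = 1 := by
  simp [ddx, x, xInv, euler_single, AddMonoidAlgebra.single_mul_single,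
    AddMonoidAlgebra.one_def, ← Prod.zero_eq_mk]
theorem ddx_tau : ddx tau = 0 := by
  simp [ddx, tau, euler_single]
theorem ddtau_x : ddtau x = 0 := by
  simp [ddtau, x, euler_single]
theorem ddtau_tau : ddtau tau = 1 := by
  simp [ddtau, tau, theta, euler_single, AddMonoidAlgebra.single_mul_single,
    AddMonoidAlgebra.one_def, ← Prod.zero_eq_mk]

/-- `ℂ[x, x⁻¹, θ]`; the monomial `x^a θ^b` has exponent `(a, b)`. -/
abbrev A₀ : Type := AddMonoidAlgebra ℂ (ℤ × ℕ)

/-- `ℂ[x, θ, θ⁻¹]`; the monomial `x^a θ^b` has exponent `(a, b)`. -/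
abbrev R : Type := AddMonoidAlgebra ℂ (ℕ × ℤ)

/-- The inclusion `ℂ[x, x⁻¹, θ] → ℂ[x, x⁻¹, θ, θ⁻¹]`. -/
def inclA₀ : A₀ →ₐ[ℂ] A :=
  AddMonoidAlgebra.mapDomainAlgHom ℂ ℂ ((AddMonoidHom.id ℤ).prodMap (Nat.castAddMonoidHom ℤ))

/-- The inclusion `ℂ[x, θ, θ⁻¹] → ℂ[x, x⁻¹, θ, θ⁻¹]`. -/
def inclR : R →ₐ[ℂ] A :=
  AddMonoidAlgebra.mapDomainAlgHom ℂ ℂ ((Nat.castAddMonoidHom ℤ).prodMap (AddMonoidHom.id ℤ))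

instance : Algebra A₀ A := inclA₀.toRingHom.toAlgebra
instance : Algebra R A := inclR.toRingHom.toAlgebra

/-- `x`, as an element of `ℂ[x, x⁻¹, θ]`. -/
def xA₀ : A₀ := AddMonoidAlgebra.single (1, 0) 1
/-- `θ`, as an element of `ℂ[x, x⁻¹, θ]`. -/
def thetaA₀ : A₀ := AddMonoidAlgebra.single (0, 1) 1
/-- `x`, as an element of `ℂ[x, θ, θ⁻¹]`. -/
def xR : R := AddMonoidAlgebra.single (1, 0) 1
/-- `θ`, as an element of `ℂ[x, θ, θ⁻¹]`. -/
def thetaR : R := AddMonoidAlgebra.single (0, 1) 1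

instance : IsScalarTower ℂ A₀ A := IsScalarTower.of_algebraMap_eq fun r =>
  (inclA₀.commutes r).symm
instance : IsScalarTower ℂ R A := IsScalarTower.of_algebraMap_eq fun r =>
  (inclR.commutes r).symm

theorem algebraMap_xA₀ : algebraMap A₀ A xA₀ = x := by
  change inclA₀ xA₀ = x
  simp [inclA₀, xA₀, x]
theorem algebraMap_thetaA₀ : algebraMap A₀ A thetaA₀ = theta := by
  change inclA₀ thetaA₀ = theta
  simp [inclA₀, thetaA₀, theta]
theorem algebraMap_xR : algebraMap R A xR = x := by
  change inclR xR = x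
  simp [inclR, xR, x]
theorem algebraMap_thetaR : algebraMap R A thetaR = theta := by
  change inclR thetaR = theta
  simp [inclR, thetaR, theta]

/-! ### Algebraic differential forms on the torus `U = (ℂ^*)ⁿ` -/

/-- The coordinate ring `ℂ[u₁, u₁⁻¹, …, uₙ, uₙ⁻¹]` of `U = (ℂ^*)ⁿ`. -/
abbrev S (n : ℕ) : Type := AddMonoidAlgebra ℂ (Fin n → ℤ)

/-- The module `Ω^p(U)` of algebraic `p`-forms on `U`. -/
abbrev Forms (n p : ℕ) : Type := ⋀[S n]^p Ω[S n⁄ℂ]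

/-- The universal derivation `d : 𝒪(U) → Ω¹(U)`. -/
abbrev d (n : ℕ) : Derivation ℂ (S n) Ω[S n⁄ℂ] := KaehlerDifferential.D ℂ (S n)

/-- The Laurent monomial `u₁^{r₁} ⋯ uₙ^{rₙ}`. -/
def mono {n : ℕ} (r : Fin n → ℤ) : S n := AddMonoidAlgebra.single r 1

/-- The coordinate `uᵢ`. -/
def u {n : ℕ} (i : Fin n) : S n := mono (Pi.single i 1)

/-- `u₀ = 1 / (u₁^{w₁} ⋯ uₙ^{wₙ})`. -/
def u₀ {n : ℕ} (w : Fin n → ℕ) : S n := mono (fun i => -(w i : ℤ))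

/-- The exterior product `η ↦ α ∧ η` with a one-form, `Ω^p(U) → Ω^q(U)` for `q = p + 1`. -/
def wedge {n p q : ℕ} (h : p + 1 = q) (α : Ω[S n⁄ℂ]) : Forms n p →ₗ[S n] Forms n q :=
  (LinearMap.mulLeft (S n) (ExteriorAlgebra.ι (S n) α)).restrict (by
    intro η hη
    subst h
    rw [ExteriorAlgebra.exteriorPower, pow_succ']
    exact Submodule.mul_mem_mul (LinearMap.mem_range_self _ α) hη)

/-- `dc₁ ∧ ⋯ ∧ dc_p`. -/
def dd {n p : ℕ} (c : Fin p → S n) : Forms n p :=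
  exteriorPower.ιMulti (S n) p (fun i => d n (c i))

/-- The volume form `du₁/u₁ ∧ ⋯ ∧ duₙ/uₙ`. -/
def vol (n : ℕ) : Forms n n :=
  exteriorPower.ιMulti (S n) n (fun i => mono (-Pi.single i 1) • d n (u i))

/-! ### The Gauss–Manin system and the Brieskorn lattice of
`F = u₁ + ⋯ + uₙ + x u₀`, over a `ℂ`-algebra `B` with a chosen element `x` -/

section Relative

variable (B : Type) [CommRing B] [Algebra ℂ B] (xB : B) {n : ℕ} (w : Fin n → ℕ)

/-- The forms `Ω^p(U) ⊗ B`. For `B = ℂ[x, x⁻¹, τ, τ⁻¹]` this is `Ω^p(U)[x, x⁻¹, τ, τ⁻¹]`. -/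
abbrev RelForms (n p : ℕ) : Type := B ⊗[ℂ] Forms n p

/-- Multiplication of relative forms by a function `g` on `U`. -/
def mulBy (p : ℕ) (g : S n) : RelForms B n p →ₗ[B] RelForms B n p :=
  ((LinearMap.lsmul (S n) (Forms n p) g).restrictScalars ℂ).baseChange B

/-- The exterior product of relative forms with a one-form `α` on `U`. -/
def wedgeBy {p q : ℕ} (h : p + 1 = q) (α : Ω[S n⁄ℂ]) : RelForms B n p →ₗ[B] RelForms B n q :=
  ((wedge h α).restrictScalars ℂ).baseChange B

/-- Multiplication of relative forms by `F = u₁ + ⋯ + uₙ + x u₀`. -/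
def mulF (p : ℕ) : RelForms B n p →ₗ[B] RelForms B n p :=
  (∑ i, mulBy B p (u i)) + xB • mulBy B p (u₀ w)

/-- `η ↦ d_u F ∧ η`, where `d_u F = du₁ + ⋯ + duₙ + x du₀`. -/
def dFwedge {p q : ℕ} (h : p + 1 = q) : RelForms B n p →ₗ[B] RelForms B n q :=
  (∑ i, wedgeBy B h (d n (u i))) + xB • wedgeBy B h (d n (u₀ w))

/-- The submodule `(s d_u - t d_u F) ∧ Ω^{n-1}(U) ⊗ B` of `Ω^n(U) ⊗ B`, for `s, t ∈ B`.
The forms `η = b dc₁ ∧ ⋯ ∧ dc_{n-1}` with `b` and the `cᵢ` in `𝒪(U)` span `Ω^{n-1}(U)`,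
and `d_u η = db ∧ dc₁ ∧ ⋯ ∧ dc_{n-1}`. -/
def twistedRel (s t : B) : Submodule B (RelForms B n n) :=
  Submodule.span B {z | ∃ (p : ℕ) (h : p + 1 = n) (b : S n) (c : Fin p → S n),
    z = s • ((1 : B) ⊗ₜ[ℂ] wedge h (d n b) (dd c)) -
      t • dFwedge B xB w h ((1 : B) ⊗ₜ[ℂ] (b • dd c))}

end Relative

variable {n : ℕ} (w : Fin n → ℕ)

/-- The Gauss–Manin system
`G = Ω^n(U)[x, x⁻¹, τ, τ⁻¹] / (d_u - τ d_u F) ∧ Ω^{n-1}(U)[x, x⁻¹, τ, τ⁻¹]`. -/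
abbrev G : Type := RelForms A n n ⧸ twistedRel A x w 1 tau

/-- The Brieskorn lattice
`G₀ = Ω^n(U)[x, x⁻¹, θ] / (θ d_u - d_u F) ∧ Ω^{n-1}(U)[x, x⁻¹, θ]`. -/
abbrev G₀ : Type := RelForms A₀ n n ⧸ twistedRel A₀ xA₀ w thetaA₀ 1

/-- The inclusion `Ω^p(U)[x, x⁻¹, θ] → Ω^p(U)[x, x⁻¹, τ, τ⁻¹]`. -/
def inclForms (n p : ℕ) : RelForms A₀ n p →ₗ[A₀] RelForms A n p :=
  TensorProduct.AlgebraTensorModule.map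
    (Algebra.linearMap A₀ A) (LinearMap.id : Forms n p →ₗ[ℂ] Forms n p)

theorem inclForms_tmul (n p : ℕ) (a : A₀) (η : Forms n p) :
    inclForms n p (a ⊗ₜ η) = algebraMap A₀ A a ⊗ₜ η := rfl

theorem inclForms_dFwedge {p : ℕ} (h : p + 1 = n) (z : RelForms A₀ n p) :
    inclForms n n (dFwedge A₀ xA₀ w h z) = dFwedge A x w h (inclForms n p z) := by
  induction z using TensorProduct.induction_on with
  | zero => simp
  | add z z' hz hz' => simp only [map_add, hz, hz']
  | tmul a η =>
    simp [dFwedge, wedgeBy, inclForms_tmul, TensorProduct.smul_tmul', algebraMap_xA₀]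

/-- The natural map `G₀ → G`. -/
def toG : G₀ w →ₗ[A₀] G w :=
  (twistedRel A₀ xA₀ w thetaA₀ 1).liftQ
    (((twistedRel A x w 1 tau).mkQ.restrictScalars A₀) ∘ₗ inclForms n n) (by
      rw [twistedRel, Submodule.span_le]
      rintro z ⟨p, h, b, c, rfl⟩
      have h1 : inclForms n n (thetaA₀ • ((1 : A₀) ⊗ₜ[ℂ] wedge h (d n b) (dd c)) -
          (1 : A₀) • dFwedge A₀ xA₀ w h ((1 : A₀) ⊗ₜ[ℂ] (b • dd c))) =
          theta • ((1 : A) • ((1 : A) ⊗ₜ[ℂ] wedge h (d n b) (dd c)) -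
            tau • dFwedge A x w h ((1 : A) ⊗ₜ[ℂ] (b • dd c))) := by
        rw [smul_sub, smul_smul theta tau, theta_mul_tau, map_sub, map_smul, map_smul,
          inclForms_dFwedge, inclForms_tmul, inclForms_tmul, one_smul, one_smul, one_smul,
          ← algebraMap_smul A thetaA₀, algebraMap_thetaA₀, map_one]
      simp only [SetLike.mem_coe, LinearMap.mem_ker, LinearMap.comp_apply, h1,
        LinearMap.restrictScalars_apply, Submodule.mkQ_apply, Submodule.Quotient.mk_eq_zero]
      exact Submodule.smul_mem _ _ (Submodule.subset_span ⟨p, h, b, c, rfl⟩))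

/-! ### The connection -/

/-- A derivation `δ` of `ℂ[x, x⁻¹, τ, τ⁻¹]`, acting on the coefficients of relative forms. -/
def coeffDer (n p : ℕ) (δ : Derivation ℂ A A) : RelForms A n p →ₗ[ℂ] RelForms A n p :=
  TensorProduct.map δ.toLinearMap LinearMap.id

theorem coeffDer_smul (p : ℕ) (δ : Derivation ℂ A A) (a : A) (z : RelForms A n p) :
    coeffDer n p δ (a • z) = δ a • z + a • coeffDer n p δ z := by
  induction z using TensorProduct.induction_on with
  | zero => simp
  | add z z' hz hz' => simp only [smul_add, map_add, hz, hz']; abel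
  | tmul b η =>
    simp only [coeffDer, TensorProduct.smul_tmul', TensorProduct.map_tmul, smul_eq_mul,
      LinearMap.id_apply]
    rw [← TensorProduct.add_tmul]
    congr 1
    simp [Derivation.leibniz, mul_comm, add_comm]

/-- `∂_τ - F` on `Ω^n(U)[x, x⁻¹, τ, τ⁻¹]`, that is `ω τ^i ↦ i ω τ^{i-1} - F ω τ^i`. -/
def preNablaTau : RelForms A n n →ₗ[ℂ] RelForms A n n :=
  coeffDer n n ddtau - (mulF A x w n).restrictScalars ℂ

/-- `ℒ_{∂_x} - τ ∂F/∂x` on `Ω^n(U)[x, x⁻¹, τ, τ⁻¹]`, where `∂F/∂x = u₀`, that is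
`ω τ^i ↦ ℒ_{∂_x}(ω) τ^i - (∂F/∂x) ω τ^{i+1}`. The Lie derivative acts on coefficients only,
because the `uᵢ` do not depend on `x`. -/
def preNablaX : RelForms A n n →ₗ[ℂ] RelForms A n n :=
  coeffDer n n ddx - (tau • mulBy A n (u₀ w)).restrictScalars ℂ

/-- The generators of `(d_u - τ d_u F) ∧ Ω^{n-1}(U)[x, x⁻¹, τ, τ⁻¹]`. -/
def gen {p : ℕ} (h : p + 1 = n) (b : S n) (c : Fin p → S n) : RelForms A n n :=
  (1 : A) • ((1 : A) ⊗ₜ[ℂ] wedge h (d n b) (dd c)) -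
    tau • dFwedge A x w h ((1 : A) ⊗ₜ[ℂ] (b • dd c))

theorem gen_mem {p : ℕ} (h : p + 1 = n) (b : S n) (c : Fin p → S n) :
    gen w h b c ∈ twistedRel A x w 1 tau :=
  Submodule.subset_span ⟨p, h, b, c, rfl⟩

theorem wedge_add {p q : ℕ} (h : p + 1 = q) (α β : Ω[S n⁄ℂ]) (η : Forms n p) :
    wedge h (α + β) η = wedge h α η + wedge h β η := by
  ext; simp [wedge, add_mul]

theorem wedge_smul {p q : ℕ} (h : p + 1 = q) (g : S n) (α : Ω[S n⁄ℂ]) (η : Forms n p) :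
    wedge h (g • α) η = g • wedge h α η := by
  ext; simp [wedge]

theorem dFwedge_mulBy {p : ℕ} (h : p + 1 = n) (g : S n) (η : Forms n p) :
    mulBy A n g (dFwedge A x w h ((1 : A) ⊗ₜ[ℂ] η)) =
      dFwedge A x w h ((1 : A) ⊗ₜ[ℂ] (g • η)) := by
  simp [dFwedge, wedgeBy, mulBy]

theorem mulBy_gen {p : ℕ} (h : p + 1 = n) (g b : S n) (c : Fin p → S n) :
    mulBy A n g (gen w h b c) =
      gen w h (g * b) c - (1 : A) ⊗ₜ[ℂ] wedge h (d n g) (b • dd c) := by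
  have e : mulBy A n g ((1 : A) ⊗ₜ[ℂ] wedge h (d n b) (dd c)) =
      (1 : A) ⊗ₜ[ℂ] wedge h (d n (g * b)) (dd c) -
        (1 : A) ⊗ₜ[ℂ] wedge h (d n g) (b • dd c) := by
    rw [← TensorProduct.tmul_sub]
    simp only [mulBy, LinearMap.baseChange_tmul, LinearMap.restrictScalars_apply,
      LinearMap.lsmul_apply, Derivation.leibniz, wedge_add, wedge_smul, map_smul]
    congr 1
    abel
  have e' : (g * b) • dd (n := n) c = g • (b • dd (n := n) c) := mul_smul g b (dd c)
  simp only [gen, map_sub, map_smul, e, dFwedge_mulBy, one_smul, e']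
  abel

theorem coeffDer_tmul_one (p : ℕ) (δ : Derivation ℂ A A) (η : Forms n p) :
    coeffDer n p δ ((1 : A) ⊗ₜ[ℂ] η) = 0 := by
  simp [coeffDer]

theorem coeffDer_dFwedge {p : ℕ} (h : p + 1 = n) (δ : Derivation ℂ A A) (η : Forms n p) :
    coeffDer n n δ (dFwedge A x w h ((1 : A) ⊗ₜ[ℂ] η)) =
      δ x • ((1 : A) ⊗ₜ[ℂ] wedge h (d n (u₀ w)) η) := by
  simp [dFwedge, wedgeBy, coeffDer_smul, coeffDer_tmul_one]

theorem coeffDer_gen {p : ℕ} (h : p + 1 = n) (δ : Derivation ℂ A A) (b : S n)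
    (c : Fin p → S n) :
    coeffDer n n δ (gen w h b c) =
      -(δ tau • dFwedge A x w h ((1 : A) ⊗ₜ[ℂ] (b • dd c))
        + (tau * δ x) • ((1 : A) ⊗ₜ[ℂ] wedge h (d n (u₀ w)) (b • dd c))) := by
  simp only [gen, map_sub, coeffDer_smul, coeffDer_tmul_one, coeffDer_dFwedge, smul_smul]
  simp

theorem preNablaTau_mem (z : RelForms A n n) (hz : z ∈ twistedRel A x w 1 tau) :
    preNablaTau w z ∈ twistedRel A x w 1 tau := by
  induction hz using Submodule.span_induction with
  | zero => simp
  | add y z _ _ hy hz => rw [map_add]; exact add_mem hy hz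
  | smul a z hz' hz =>
    have : preNablaTau w (a • z) = ddtau a • z + a • preNablaTau w z := by
      simp only [preNablaTau, LinearMap.sub_apply, coeffDer_smul,
        LinearMap.restrictScalars_apply, map_smul, smul_sub]
      abel
    rw [this]
    exact add_mem (Submodule.smul_mem _ _ hz') (Submodule.smul_mem _ _ hz)
  | mem z hz =>
    obtain ⟨p, h, b, c, rfl⟩ := hz
    change preNablaTau w (gen w h b c) ∈ _
    have : preNablaTau w (gen w h b c) =
        -((∑ i, gen w h (u i * b) c) + x • gen w h (u₀ w * b) c) := by
      simp only [preNablaTau, LinearMap.sub_apply, coeffDer_gen, ddtau_x, ddtau_tau,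
        LinearMap.restrictScalars_apply, mulF, LinearMap.add_apply, LinearMap.sum_apply,
        LinearMap.smul_apply, mulBy_gen]
      simp only [dFwedge, wedgeBy, LinearMap.add_apply, LinearMap.sum_apply,
        LinearMap.smul_apply, LinearMap.baseChange_tmul, LinearMap.restrictScalars_apply,
        Finset.sum_sub_distrib, smul_sub, one_smul, mul_zero, zero_smul, add_zero]
      abel
    rw [this]
    exact neg_mem (add_mem (sum_mem fun i _ => gen_mem w h _ c)
      (Submodule.smul_mem _ _ (gen_mem w h _ c)))

theorem preNablaX_mem (z : RelForms A n n) (hz : z ∈ twistedRel A x w 1 tau) :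
    preNablaX w z ∈ twistedRel A x w 1 tau := by
  induction hz using Submodule.span_induction with
  | zero => simp
  | add y z _ _ hy hz => rw [map_add]; exact add_mem hy hz
  | smul a z hz' hz =>
    have : preNablaX w (a • z) = ddx a • z + a • preNablaX w z := by
      simp only [preNablaX, LinearMap.sub_apply, coeffDer_smul,
        LinearMap.restrictScalars_apply, map_smul, smul_sub]
      abel
    rw [this]
    exact add_mem (Submodule.smul_mem _ _ hz') (Submodule.smul_mem _ _ hz)
  | mem z hz =>
    obtain ⟨p, h, b, c, rfl⟩ := hz
    change preNablaX w (gen w h b c) ∈ _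
    have : preNablaX w (gen w h b c) = -(tau • gen w h (u₀ w * b) c) := by
      simp only [preNablaX, LinearMap.sub_apply, coeffDer_gen, ddx_x, ddx_tau,
        LinearMap.restrictScalars_apply, LinearMap.smul_apply, mulBy_gen, smul_sub, mul_one,
        zero_smul, zero_add]
      abel
    rw [this]
    exact neg_mem (Submodule.smul_mem _ _ (gen_mem w h _ c))

/-- A `ℂ`-linear operator on forms which preserves the relations, on the quotient `G`. -/
def descend (T : RelForms A n n →ₗ[ℂ] RelForms A n n)
    (hT : ∀ z ∈ twistedRel A x w 1 tau, T z ∈ twistedRel A x w 1 tau) : G w →ₗ[ℂ] G w :=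
  let e := Submodule.Quotient.restrictScalarsEquiv ℂ (twistedRel A x w 1 tau)
  e.toLinearMap ∘ₗ Submodule.mapQ ((twistedRel A x w 1 tau).restrictScalars ℂ)
    ((twistedRel A x w 1 tau).restrictScalars ℂ) T hT ∘ₗ e.symm.toLinearMap

theorem descend_mk (T : RelForms A n n →ₗ[ℂ] RelForms A n n)
    (hT : ∀ z ∈ twistedRel A x w 1 tau, T z ∈ twistedRel A x w 1 tau) (z : RelForms A n n) :
    descend w T hT ((twistedRel A x w 1 tau).mkQ z) = (twistedRel A x w 1 tau).mkQ (T z) := rfl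

/-- `∇_{∂_τ}` on `G`. -/
def nablaTau : G w →ₗ[ℂ] G w := descend w (preNablaTau w) (preNablaTau_mem w)

/-- `∇_{∂_x}` on `G`. -/
def nablaX : G w →ₗ[ℂ] G w := descend w (preNablaX w) (preNablaX_mem w)

/-- `∇_{∂_θ} = -τ² ∇_{∂_τ}` on `G`, since `θ = τ⁻¹`. -/
def nablaTheta (g : G w) : G w := -(tau ^ 2) • nablaTau w g

/-! ### Combinatorics of the weights `(w₀, w₁, …, wₙ)` with `w₀ = 1` -/

/-- The weights `(w₀, w₁, …, wₙ)`, where `w₀ = 1`. -/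
def W : Fin (n + 1) → ℕ := Fin.cons 1 w

/-- `μ = w₀ + w₁ + ⋯ + wₙ`. -/
def mu : ℕ := ∑ i, W w i

/-- The set of the fractions `ℓ / wᵢ` with `0 ≤ ℓ ≤ wᵢ - 1` and `0 ≤ i ≤ n`. -/
def fractions : Finset ℚ :=
  Finset.univ.biUnion fun i => (Finset.range (W w i)).image fun ℓ : ℕ => (ℓ : ℚ) / W w i

open Classical in
/-- `S_f = {j | w_j f ∈ ℤ}`. -/
def indexSet (f : ℚ) : Finset (Fin (n + 1)) :=
  Finset.univ.filter fun j => ∃ z : ℤ, (W w j : ℚ) * f = z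

/-- The sequence `c₀, …, c_{μ-1}`: the fractions in increasing order, each fraction `f`
repeated `#S_f` times. -/
def cList : List ℚ := (fractions w).sort.flatMap fun f => List.replicate (indexSet w f).card f

/-- The number `c_k`, for `k < μ`. -/
def c (k : ℕ) : ℚ := (cList w).getD k 0

/-- The number `α_k = k - μ c_k`, for `k < μ`. -/
def alpha (k : ℕ) : ℚ := k - mu w * c w k

theorem exists_argmin (a : Fin (n + 1) → ℕ) :
    (Finset.univ.filter fun i => ∀ j, (a i : ℚ) / W w i ≤ (a j : ℚ) / W w j).Nonempty := by
  obtain ⟨i, -, hi⟩ := Finset.exists_min_image Finset.univ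
    (fun i => (a i : ℚ) / W w i) Finset.univ_nonempty
  exact ⟨i, by simpa using hi⟩

/-- The least index `i` with `aᵢ / wᵢ = min_j a_j / w_j`. -/
def argmin (a : Fin (n + 1) → ℕ) : Fin (n + 1) :=
  (Finset.univ.filter fun i => ∀ j, (a i : ℚ) / W w i ≤ (a j : ℚ) / W w j).min'
    (exists_argmin w a)

/-- The multi-indices `a(k)`: `a(0) = 0` and `a(k+1) = a(k) + 1_{i(k)}`, where `i(k)` is the
least index `i` with `a(k)ᵢ / wᵢ` minimal. -/
def a : ℕ → Fin (n + 1) → ℕ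
  | 0 => 0
  | k + 1 => a k + Pi.single (argmin w (a k)) 1

/-! ### The classes `ω_k` and the matrices -/

/-- `ω₀` is the class of `du₁/u₁ ∧ ⋯ ∧ duₙ/uₙ`, and for `k ≥ 1`
`ω_k = x / (w₁^{a(k)₁} ⋯ wₙ^{a(k)ₙ}) u₀ u₁^{a(k)₁} ⋯ uₙ^{a(k)ₙ} ω₀`, in `G₀`. -/
def omega (k : ℕ) : G₀ w :=
  (twistedRel A₀ xA₀ w thetaA₀ 1).mkQ <|
    if k = 0 then 1 ⊗ₜ[ℂ] vol n
    else (((∏ i : Fin n, (w i : ℂ) ^ a w k i.succ)⁻¹ : ℂ) • xA₀) ⊗ₜ[ℂ]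
      ((u₀ w * ∏ i : Fin n, u i ^ a w k i.succ) • vol n)

/-- The matrix `A₀^φ(x)`: entries `μ` just below the diagonal, `μ x / (w₁^{w₁} ⋯ wₙ^{wₙ})` in
the upper right corner, and `0` elsewhere. -/
def A0phi : Matrix (Fin (mu w)) (Fin (mu w)) A := fun i j =>
  if (i : ℕ) = j + 1 then algebraMap ℂ A (mu w)
  else if (i : ℕ) = 0 ∧ (j : ℕ) + 1 = mu w then
    algebraMap ℂ A (mu w / ∏ i : Fin n, (w i : ℂ) ^ w i) * x
  else 0

/-- `A_∞ = diag(α₀, …, α_{μ-1})`. -/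
def Ainf : Matrix (Fin (mu w)) (Fin (mu w)) A :=
  Matrix.diagonal fun k => algebraMap ℂ A (alpha w k : ℂ)

/-- `H = diag(0, 1, …, μ-1)`. -/
def H : Matrix (Fin (mu w)) (Fin (mu w)) A :=
  Matrix.diagonal fun k => algebraMap ℂ A (k : ℂ)

/-- `(A₀^φ(x)/θ + A_∞)/θ`, where `1/θ = τ`. -/
def thetaMatrix : Matrix (Fin (mu w)) (Fin (mu w)) A :=
  tau • (tau • A0phi w + Ainf w)

/-- `(-A₀^φ(x)/θ - A_∞ + H)/(μ x)`. -/
def xMatrix : Matrix (Fin (mu w)) (Fin (mu w)) A :=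
  (algebraMap ℂ A (1 / mu w) * xInv) • (-(tau • A0phi w) - Ainf w + H w)

/-! ### Deligne's canonical extension at `x = 0` -/

/-- The ideal `(x, θ - t)` of `ℂ[x, θ, θ⁻¹]`, of the point `(0, t)`. -/
def pointIdeal (t : ℂ) : Ideal R := Ideal.span {xR, thetaR - algebraMap ℂ R t}

/-- `L` is Deligne's canonical extension of `(G, ∇)` along `x = 0`, with the eigenvalues of
the residue of `∇_{∂_x}` in `[0, 1[`: it is a locally free `ℂ[x, θ, θ⁻¹]`-lattice in `G` on which
`∇` has a logarithmic pole along `x = 0`, and at every point `(0, t)` with `t ∈ ℂ^*`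
the eigenvalues of the residue, the endomorphism induced by `x ∇_{∂_x}` on the fibre
`L / (x, θ - t) L`, lie in `[0, 1[`. -/
structure IsDeligneExtension (L : Submodule R (G w)) : Prop where
  finite : L.FG
  projective : Module.Projective R L
  lattice : ∀ g : G w, ∃ m : ℕ, x ^ m • g ∈ L
  log_x : ∀ g ∈ L, x • nablaX w g ∈ L
  log_theta : ∀ g ∈ L, nablaTheta w g ∈ L
  residue : ∀ (t : ℂ), t ≠ 0 → ∀ (lam : ℂ) (v : G w), v ∈ L → v ∉ pointIdeal t • L →
    x • nablaX w v - lam • v ∈ pointIdeal t • L → ∃ r : ℝ, r ∈ Set.Ico (0 : ℝ) 1 ∧ lam = r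

end BModel

end

noncomputable section

namespace BModel

/-! ### Combinatorics of the multi-indices -/

section Combinatorics

variable {n : ℕ} {w : Fin n → ℕ}

/-! Put v₀ = x u₀ and vᵢ = uᵢ/wᵢ, and write [v^b] for the class of v^b ω₀, with b ∈ ℕ^{n+1}. Then F
= Σ w_j v_j, and v^W = κ x with κ = ∏ wᵢ^{-wᵢ}. The relations in G₀ and in G amount to [v^{b+1_i}] −
[v^{b+1_j}] = θ (b_i/w_i − b_j/w_j) [v^b] for all b, i, j (`vClass_add_sub`), together with
[v^{b+W}] = κ x [v^b] (`vClass_add_W`). The class ω_k is [v^{a(k)}] (`omega_eq_vClass`).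

Generation: by the first relation, classes of equal degree |b| agree modulo classes of smaller
degree, so one exponent per degree is enough. In degree qμ + r with r < μ, the exponent a(r) + qW
gives (κx)^q ω_r (`vClass_mem_span`).

Independence: a model of the quotient is built on B^μ, where B is the coefficient ring. The operator
−θ x∇_x sends [v^b] to [v^{b+1_i}] − θ (b_i/w_i)[v^b], for every i. Conversely, let D be the
operator on B^μ given by this formula on e_k ↔ v^{a(k)}. The operators D + θ q with q ∈ ℂ commute,
so f(b + 1_i) = (D + θ b_i/w_i) f(b) and f(0) = e₀ define a function f on all exponents
(`exists_modelFun`). It satisfies f(a(k)) = e_k and f(b + W) = κ x f(b), hence descends to Laurent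
monomials and then to a linear map that kills all relations and sends ω_k to e_k
(`formLift_mem_ker`, `linearIndependent_vClass`).

Connection: with i = i(k), the quotient b_i/w_i at b = a(k) is the minimum `slope w k`, and
v^{b+1_i} = v^{a(k+1)}. This gives ∇_x directly, and ∇_τ after every summand w_j v_j of F is moved
to the index i. That `slope w k` equals c_k is a counting argument: for k < μ the slopes do not
decrease, and they run through the fractions ℓ/wᵢ, one for each pair (i, ℓ) with ℓ < wᵢ
(`c_eq_slope`).

Canonical extension: at x = 0 the corner entry vanishes, so the residue is lower triangular with
diagonal entries c_k ∈ [0,1[ (`residue_eigenvalue`). -/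

theorem W_pos (hw : ∀ i, 0 < w i) (i : Fin (n + 1)) : 0 < W w i := by
  refine Fin.cases ?_ (fun j => ?_) i
  · simp [W]
  · simpa [W] using hw j

@[simp] theorem W_zero : W w 0 = 1 := rfl
@[simp] theorem W_succ (i : Fin n) : W w i.succ = w i := rfl

variable (w) in
/-- The minimum of the quotients `a(k)_j / w_j`. -/
def slope (k : ℕ) : ℚ := (a w k (argmin w (a w k)) : ℚ) / W w (argmin w (a w k))

theorem argmin_le (b : Fin (n + 1) → ℕ) (j : Fin (n + 1)) :
    (b (argmin w b) : ℚ) / W w (argmin w b) ≤ (b j : ℚ) / W w j :=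
  (Finset.mem_filter.1 (Finset.min'_mem _ (exists_argmin w b))).2 j

theorem slope_le (k : ℕ) (j : Fin (n + 1)) : slope w k ≤ (a w k j : ℚ) / W w j :=
  argmin_le _ j

theorem a_succ (k : ℕ) : a w (k + 1) = a w k + Pi.single (argmin w (a w k)) 1 := rfl

theorem sum_a (k : ℕ) : ∑ i, a w k i = k := by
  induction k with
  | zero => simp [a]
  | succ k ih => simp [a_succ, Finset.sum_add_distrib, ih]

theorem a_le_a_succ (k : ℕ) (j : Fin (n + 1)) : a w k j ≤ a w (k + 1) j := by
  simp [a_succ]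

theorem slope_nonneg (k : ℕ) : 0 ≤ slope w k := by unfold slope; positivity

theorem slope_le_succ (k : ℕ) : slope w k ≤ slope w (k + 1) :=
  (slope_le k _).trans (by
    unfold slope
    gcongr
    exact_mod_cast a_le_a_succ k _)

/-- If all quotients were at least 1, then a(k) ≥ W coordinatewise, and comparing sums would give k
≥ μ. -/
theorem slope_lt_one (hw : ∀ i, 0 < w i) {k : ℕ} (hk : k < mu w) : slope w k < 1 := by
  by_contra! h
  have h1 : ∀ j, W w j ≤ a w k j := fun j => by
    have := h.trans (slope_le k j)
    rw [le_div_iff₀ (by exact_mod_cast W_pos hw j), one_mul] at this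
    exact_mod_cast this
  have := Finset.sum_le_sum fun j (_ : j ∈ Finset.univ) => h1 j
  rw [sum_a] at this
  exact absurd this (not_le.2 hk)

/-- A coordinate is raised only when its quotient is the slope, hence is less than 1; so it stays
within its weight. -/
theorem a_le (hw : ∀ i, 0 < w i) {k : ℕ} (hk : k ≤ mu w) (j : Fin (n + 1)) :
    a w k j ≤ W w j := by
  induction k with
  | zero => simp [a]
  | succ k ih =>
    have h1 := slope_lt_one hw (Nat.lt_of_succ_le hk)
    rw [a_succ, Pi.add_apply]
    by_cases hj : j = argmin w (a w k)
    · subst hj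
      rw [slope, div_lt_one (by exact_mod_cast W_pos hw _)] at h1
      simpa using Nat.succ_le_of_lt (by exact_mod_cast h1)
    · simpa [Pi.single_apply, hj] using ih (by omega)

theorem a_mu (hw : ∀ i, 0 < w i) : a w (mu w) = W w := by
  have h := sum_a (w := w) (mu w)
  have := (Finset.sum_eq_sum_iff_of_le fun j (_ : j ∈ Finset.univ) => a_le hw le_rfl j).1 h
  exact funext fun j => this j (Finset.mem_univ j)

theorem argmin_zero : argmin w 0 = 0 :=
  Fin.le_zero_iff.1 (Finset.min'_le _ _ (by simp))

/-- At the start all quotients are 0 and the tie goes to the index 0; as w₀ = 1, that coordinate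
never moves again up to μ. This is why exactly one factor x u₀ occurs in ω_k for k ≥ 1. -/
theorem a_apply_zero (hw : ∀ i, 0 < w i) {k : ℕ} (hk : k ≤ mu w) (hk0 : k ≠ 0) :
    a w k 0 = 1 := by
  refine le_antisymm (by simpa using a_le hw hk 0) ?_
  obtain ⟨k, rfl⟩ := Nat.exists_eq_succ_of_ne_zero hk0
  clear hk hk0
  induction k with
  | zero => simp [a, argmin_zero]
  | succ k ih => exact ih.trans (a_le_a_succ _ _)

theorem mu_pos : 0 < mu w :=
  lt_of_lt_of_le (by simp) (Finset.single_le_sum (fun _ _ => Nat.zero_le _) (Finset.mem_univ 0))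

/-! ### Counting the fractions ℓ/wᵢ with multiplicity -/

variable (w) in
/-- The number of pairs `(i, ℓ)` with `ℓ < bᵢ` and `ℓ / wᵢ = f`. -/
def fractionCount (b : Fin (n + 1) → ℕ) (f : ℚ) : ℕ :=
  ∑ i, ∑ ℓ ∈ Finset.range (b i), if (ℓ : ℚ) / W w i = f then 1 else 0

theorem fractionCount_add_single (b : Fin (n + 1) → ℕ) (i : Fin (n + 1)) (f : ℚ) :
    fractionCount w (b + Pi.single i 1) f =
      fractionCount w b f + if (b i : ℚ) / W w i = f then 1 else 0 := by
  unfold fractionCount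
  rw [← Finset.add_sum_erase _ _ (Finset.mem_univ i),
    ← Finset.add_sum_erase (a := i) Finset.univ (fun i => ∑ ℓ ∈ Finset.range (b i), _)
      (Finset.mem_univ i)]
  have (j) (hj : j ∈ Finset.univ.erase i) :
      (∑ ℓ ∈ Finset.range ((b + Pi.single i 1 : Fin (n + 1) → ℕ) j),
        if (ℓ : ℚ) / W w j = f then 1 else 0) =
      ∑ ℓ ∈ Finset.range (b j), if (ℓ : ℚ) / W w j = f then 1 else 0 := by
    simp [Finset.ne_of_mem_erase hj]
  rw [Finset.sum_congr rfl this]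
  simp only [Pi.add_apply, Pi.single_eq_same, Finset.sum_range_succ]
  rw [add_right_comm]

/-- The step from a(k) to a(k+1) adds just one pair (i, ℓ), namely i = i(k) and ℓ = a(k)_i, and its
fraction is the slope. -/
theorem count_map_slope (k : ℕ) (f : ℚ) :
    ((List.range k).map (slope w)).count f = fractionCount w (a w k) f := by
  induction k with
  | zero => simp [a, fractionCount]
  | succ k ih =>
    rw [List.range_succ, List.map_append, List.count_append, ih, a_succ, fractionCount_add_single]
    simp [slope, List.count_singleton]

theorem sum_range_ite (hw : ∀ i, 0 < w i) (i : Fin (n + 1)) (f : ℚ) :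
    (∑ ℓ ∈ Finset.range (W w i), if (ℓ : ℚ) / W w i = f then 1 else 0) =
      if ∃ ℓ < W w i, (ℓ : ℚ) / W w i = f then 1 else 0 := by
  have hW : (W w i : ℚ) ≠ 0 := by exact_mod_cast (W_pos hw i).ne'
  split_ifs with h
  · obtain ⟨ℓ, hℓ, rfl⟩ := h
    rw [Finset.sum_eq_single ℓ]
    · simp
    · intro m _ hm
      rw [if_neg]
      rw [div_left_inj' hW]
      exact_mod_cast hm
    · intro h; exact absurd (Finset.mem_range.2 hℓ) h
  · exact Finset.sum_eq_zero fun ℓ hℓ => if_neg fun e => h ⟨ℓ, Finset.mem_range.1 hℓ, e⟩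

theorem mem_fractions (f : ℚ) :
    f ∈ fractions w ↔ ∃ i, ∃ ℓ < W w i, (ℓ : ℚ) / W w i = f := by
  simp [fractions]

/-- A fraction f of the list satisfies 0 ≤ f < 1, so an integer w_j f lies in [0, w_j[. Hence j ∈
S_f exactly when f = ℓ/w_j for some ℓ < w_j, and this ℓ is unique. -/
theorem fractionCount_W (hw : ∀ i, 0 < w i) (f : ℚ) :
    fractionCount w (W w) f = if f ∈ fractions w then (indexSet w f).card else 0 := by
  classical
  unfold fractionCount
  rw [Finset.sum_congr rfl fun i _ => sum_range_ite hw i f]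
  split_ifs with hf
  · rw [indexSet, Finset.card_filter]
    refine Finset.sum_congr rfl fun i _ => if_congr ?_ rfl rfl
    have hW : (0 : ℚ) < W w i := by exact_mod_cast W_pos hw i
    constructor
    · rintro ⟨ℓ, -, rfl⟩
      exact ⟨ℓ, by field_simp; simp⟩
    · rintro ⟨z, hz⟩
      obtain ⟨j, m, hm, rfl⟩ := (mem_fractions f).1 hf
      have hWj : (0 : ℚ) < W w j := by exact_mod_cast W_pos hw j
      have h0 : (0 : ℚ) ≤ (m : ℚ) / W w j := by positivity
      have h1 : (m : ℚ) / W w j < 1 := by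
        rw [div_lt_one hWj]; exact_mod_cast hm
      have hz0 : 0 ≤ z := by
        have : (0 : ℚ) ≤ z := by rw [← hz]; positivity
        exact_mod_cast this
      lift z to ℕ using hz0
      refine ⟨z, ?_, ?_⟩
      · have : (z : ℚ) < W w i := by
          rw [Int.cast_natCast] at hz
          rw [← hz]; nlinarith
        exact_mod_cast this
      · rw [Int.cast_natCast] at hz
        rw [← hz]; field_simp
  · refine Finset.sum_eq_zero fun i _ => if_neg fun h => hf ?_
    exact (mem_fractions f).2 ⟨i, h⟩

theorem count_flatMap_replicate (l : List ℚ) (hl : l.Nodup) (g : ℚ → ℕ) (f : ℚ) :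
    (l.flatMap fun f => List.replicate (g f) f).count f = if f ∈ l then g f else 0 := by
  induction l with
  | nil => simp
  | cons b l ih =>
    rw [List.nodup_cons] at hl
    rw [List.flatMap_cons, List.count_append, ih hl.2, List.count_replicate]
    by_cases hb : b = f
    · subst hb; simp [hl.1]
    · simp [hb, Ne.symm hb]

theorem pairwise_flatMap_replicate (l : List ℚ) (hl : l.Pairwise (· ≤ ·)) (g : ℚ → ℕ) :
    (l.flatMap fun f => List.replicate (g f) f).Pairwise (· ≤ ·) := by
  rw [List.pairwise_flatMap]
  refine ⟨fun b _ => List.pairwise_replicate.2 (Or.inr le_rfl), hl.imp ?_⟩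
  intro b b' h y hy y' hy'
  rw [List.eq_of_mem_replicate hy, List.eq_of_mem_replicate hy']
  exact h

/-- Both lists are nondecreasing, and every fraction has the same multiplicity in both because a(μ)
= W. -/
theorem map_slope_eq_cList (hw : ∀ i, 0 < w i) :
    (List.range (mu w)).map (slope w) = cList w := by
  refine List.Perm.eq_of_pairwise' (r := (· ≤ ·)) ?_ ?_ ?_
  · rw [List.pairwise_map]
    exact List.pairwise_lt_range.imp fun h => monotone_nat_of_le_succ slope_le_succ h.le
  · exact pairwise_flatMap_replicate _ (Finset.pairwise_sort _ _) _
  · rw [List.perm_iff_count]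
    intro f
    rw [count_map_slope, a_mu hw, fractionCount_W hw, cList,
      count_flatMap_replicate _ (Finset.sort_nodup _ _)]
    simp

theorem c_eq_slope (hw : ∀ i, 0 < w i) {k : ℕ} (hk : k < mu w) : c w k = slope w k := by
  rw [c, ← map_slope_eq_cList hw]
  simp [List.getD_eq_getElem?_getD, hk]

end Combinatorics

/-! ### Forms of top degree on the torus -/

section Forms

variable {n : ℕ}

theorem mono_mul (r s : Fin n → ℤ) : mono r * mono s = mono (r + s) := by
  simp [mono, AddMonoidAlgebra.single_mul_single]

@[simp] theorem mono_zero : mono (0 : Fin n → ℤ) = 1 := rfl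

theorem mono_mul_neg (r : Fin n → ℤ) : mono r * mono (-r) = 1 := by
  rw [mono_mul, add_neg_cancel, mono_zero]

theorem prod_mono {ι : Type*} (s : Finset ι) (r : ι → Fin n → ℤ) :
    ∏ j ∈ s, mono (r j) = mono (∑ j ∈ s, r j) := by
  classical
  induction s using Finset.induction_on with
  | empty => simp
  | insert i s hi ih => rw [Finset.prod_insert hi, Finset.sum_insert hi, ih, mono_mul]

/-- The Laurent monomials form a basis of the coordinate ring of the torus. -/
def monoBasis (n : ℕ) : Module.Basis (Fin n → ℤ) ℂ (S n) :=
  Module.Basis.ofRepr (AddMonoidAlgebra.coeffLinearEquiv ℂ)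

@[simp] theorem monoBasis_apply (r : Fin n → ℤ) : monoBasis n r = mono r := rfl

/-- The derivation `uᵢ ∂/∂uᵢ`. -/
def logDer (i : Fin n) : Derivation ℂ (S n) (S n) :=
  euler ((Int.castAddHom ℂ).comp (Pi.evalAddMonoidHom (fun _ : Fin n => ℤ) i))

@[simp] theorem logDer_mono (i : Fin n) (r : Fin n → ℤ) :
    logDer i (mono r) = (r i : ℂ) • mono r := by
  simp [logDer, mono, euler_single]

/-- The one-form `duᵢ/uᵢ`. -/
def dlog (i : Fin n) : Ω[S n⁄ℂ] := mono (-Pi.single i 1) • d n (u i)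

/-- The coefficient of `duᵢ/uᵢ` in a one-form. -/
def logCoord (i : Fin n) : Ω[S n⁄ℂ] →ₗ[S n] S n := (logDer i).liftKaehlerDifferential

@[simp] theorem logCoord_d (i : Fin n) (g : S n) : logCoord i (d n g) = logDer i g :=
  Derivation.liftKaehlerDifferential_comp_D _ _

theorem logCoord_dlog (i j : Fin n) : logCoord i (dlog j) = if i = j then 1 else 0 := by
  rw [dlog, map_smul, logCoord_d, u, logDer_mono, smul_eq_mul, mul_smul_comm, mono_mul]
  by_cases h : i = j
  · subst h; simp
  · simp [h]

/-- `r ↦ d(u^r)/u^r` as a homomorphism. -/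
def logMono (n : ℕ) : (Fin n → ℤ) →+ Ω[S n⁄ℂ] where
  toFun r := mono (-r) • d n (mono r)
  map_zero' := by simp
  map_add' r s := by
    rw [← mono_mul, Derivation.leibniz, smul_add, smul_smul, smul_smul, mono_mul, mono_mul,
      add_comm]
    congr 3 <;> abel

theorem d_mono_eq_smul (r : Fin n → ℤ) : d n (mono r) = mono r • logMono n r := by
  change _ = mono r • mono (-r) • d n (mono r)
  rw [smul_smul, mono_mul_neg, one_smul]

theorem logMono_eq_sum (r : Fin n → ℤ) : logMono n r = ∑ i, r i • dlog i := by
  conv_lhs => rw [show r = ∑ i, r i • Pi.single i (1 : ℤ) by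
    ext j; simp [Finset.sum_apply, Pi.single_apply]]
  simp only [map_sum, map_zsmul]
  rfl

theorem logCoord_logMono (i : Fin n) (r : Fin n → ℤ) :
    logCoord i (logMono n r) = algebraMap ℂ (S n) (r i) := by
  change logCoord i (mono (-r) • d n (mono r)) = _
  rw [map_smul, logCoord_d, logDer_mono, smul_eq_mul, mul_smul_comm, mul_comm, mono_mul_neg,
    Algebra.algebraMap_eq_smul_one]

theorem span_range_dlog : Submodule.span (S n) (Set.range (dlog (n := n))) = ⊤ := by
  rw [eq_top_iff, ← KaehlerDifferential.span_range_derivation, Submodule.span_le]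
  rintro _ ⟨g, rfl⟩
  induction (monoBasis n).mem_span g using Submodule.span_induction with
  | zero => simp
  | add y z _ _ hy hz => rw [map_add]; exact add_mem hy hz
  | smul z g _ hg =>
    rw [Derivation.map_smul, ← algebraMap_smul (S n) z]
    exact Submodule.smul_mem _ _ hg
  | mem g hg =>
    obtain ⟨r, rfl⟩ := hg
    rw [monoBasis_apply]
    change d n (mono r) ∈ _
    rw [d_mono_eq_smul, logMono_eq_sum]
    exact Submodule.smul_mem _ _ (sum_mem fun i _ =>
      zsmul_mem (Submodule.subset_span (Set.mem_range_self i)) _)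

theorem linearIndependent_dlog : LinearIndependent (S n) (dlog (n := n)) := by
  rw [Fintype.linearIndependent_iff]
  intro g hg i
  have := congrArg (logCoord i) hg
  simpa [logCoord_dlog] using this

/-- The one-forms `duᵢ/uᵢ` form a basis of `Ω¹(U)`. -/
def dlogBasis (n : ℕ) : Module.Basis (Fin n) (S n) Ω[S n⁄ℂ] :=
  Module.Basis.mk linearIndependent_dlog span_range_dlog.ge

@[simp] theorem dlogBasis_apply (i : Fin n) : dlogBasis n i = dlog i := by simp [dlogBasis]

theorem dlogBasis_repr (α : Ω[S n⁄ℂ]) (i : Fin n) :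
    (dlogBasis n).repr α i = logCoord i α := by
  change (dlogBasis n).coord i α = logCoord i α
  congr 1
  refine (dlogBasis n).ext fun j => ?_
  rw [Module.Basis.coord_apply, Module.Basis.repr_self, dlogBasis_apply, logCoord_dlog,
    Finsupp.single_apply]
  exact if_congr eq_comm rfl rfl

theorem eq_sum_logCoord (α : Ω[S n⁄ℂ]) : α = ∑ i, logCoord i α • dlog i := by
  conv_lhs => rw [← (dlogBasis n).sum_repr α]
  simp [dlogBasis_repr]

/-- The coefficient of the volume form in a form of top degree. -/
def volCoef (n : ℕ) : Forms n n →ₗ[S n] S n :=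
  exteriorPower.alternatingMapLinearEquiv (dlogBasis n).det

theorem volCoef_vol : volCoef n (vol n) = 1 := by
  have : vol n = exteriorPower.ιMulti (S n) n (dlogBasis n) := by
    rw [vol]; congr 1; ext i; rw [dlogBasis_apply]; rfl
  rw [volCoef, this, exteriorPower.alternatingMapLinearEquiv_apply_ιMulti, Module.Basis.det_self]

/-- Top forms are spanned by wedges of distinct basis forms `dlog i`, and these are the volume form
up to sign. -/
theorem volCoef_smul_vol (η : Forms n n) : volCoef n η • vol n = η := by
  suffices h : (LinearMap.toSpanSingleton (S n) _ (vol n)) ∘ₗ volCoef n = LinearMap.id from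
    congrArg (fun f => f η) h
  refine exteriorPower.linearMap_ext ?_
  refine (dlogBasis n).ext_alternating fun v hv => ?_
  -- An injective choice of n indices is a permutation; both alternating maps change by its sign, so
  -- only the identity is left to check.
  let σ : Equiv.Perm (Fin n) := Equiv.ofBijective v (Finite.injective_iff_bijective.1 hv)
  have h := fun f : Ω[S n⁄ℂ] [⋀^Fin n]→ₗ[S n] Forms n n => f.map_perm (dlogBasis n) σ
  refine (h _).trans (Eq.trans ?_ (h _).symm)
  congr 1
  have : vol n = exteriorPower.ιMulti (S n) n (dlogBasis n) := by
    rw [vol]; congr 1; ext i; rw [dlogBasis_apply]; rfl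
  simp only [LinearMap.compAlternatingMap_apply, LinearMap.comp_apply, ← this, volCoef_vol,
    LinearMap.toSpanSingleton_apply, one_smul, LinearMap.id_apply]

/-! ### Wedge products with a one-form, in logarithmic coordinates -/

theorem wedge_ιMulti {p : ℕ} (α : Ω[S (p + 1)⁄ℂ]) (v : Fin p → Ω[S (p + 1)⁄ℂ]) :
    wedge (n := p + 1) rfl α (exteriorPower.ιMulti (S (p + 1)) p v) =
      exteriorPower.ιMulti (S (p + 1)) (p + 1) (Matrix.vecCons α v) := by
  ext
  simp [wedge, ExteriorAlgebra.ιMulti_succ_apply]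

theorem vecCons_smul {p : ℕ} {R M : Type*} [CommRing R] [AddCommGroup M] [Module R M]
    (α : M) (g : Fin p → R) (v : Fin p → M) :
    (Matrix.vecCons α fun j => g j • v j) =
      fun k => Matrix.vecCons 1 g k • Matrix.vecCons α v k := by
  ext k
  refine Fin.cases ?_ (fun j => ?_) k <;> simp

theorem ιMulti_vecCons_smul {p : ℕ} (α : Ω[S (p + 1)⁄ℂ]) (g : Fin p → S (p + 1))
    (v : Fin p → Ω[S (p + 1)⁄ℂ]) :
    exteriorPower.ιMulti (S (p + 1)) (p + 1) (Matrix.vecCons α fun j => g j • v j) =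
      (∏ j, g j) • exteriorPower.ιMulti (S (p + 1)) (p + 1) (Matrix.vecCons α v) := by
  rw [vecCons_smul]
  refine ((exteriorPower.ιMulti (S (p + 1)) (p + 1)).toMultilinearMap.map_smul_univ _ _).trans ?_
  simp [Fin.prod_univ_succ]

theorem ιMulti_vecCons_eq_zero {p : ℕ} (v : Fin p → Ω[S (p + 1)⁄ℂ]) (j : Fin p) :
    exteriorPower.ιMulti (S (p + 1)) (p + 1) (Matrix.vecCons (v j) v) = 0 :=
  AlternatingMap.map_eq_zero_of_eq _ _ (i := 0) (j := j.succ) (by simp) (Fin.succ_ne_zero j).symm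

theorem ιMulti_vecCons_sum {p : ℕ} {ι : Type*} (s : Finset ι) (g : ι → S (p + 1))
    (α : ι → Ω[S (p + 1)⁄ℂ]) (v : Fin p → Ω[S (p + 1)⁄ℂ]) :
    exteriorPower.ιMulti (S (p + 1)) (p + 1) (Matrix.vecCons (∑ i ∈ s, g i • α i) v) =
      ∑ i ∈ s, g i • exteriorPower.ιMulti (S (p + 1)) (p + 1) (Matrix.vecCons (α i) v) := by
  have h (β) : exteriorPower.ιMulti (S (p + 1)) (p + 1) (Matrix.vecCons β v) =
      (exteriorPower.ιMulti (S (p + 1)) (p + 1)).curryLeft β v := rfl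
  classical
  induction s using Finset.induction_on with
  | empty => rw [Finset.sum_empty, Finset.sum_empty, h, map_zero]; rfl
  | insert i s hi ih =>
    rw [Finset.sum_insert hi, Finset.sum_insert hi, ← ih, h, h, h, map_add, map_smul]
    rfl

/-- The contraction of the volume form, up to sign, against which one-forms give their
coefficient of `duᵢ/uᵢ`. -/
theorem exists_wedge_eq_logCoord {p : ℕ} (i : Fin (p + 1)) :
    ∃ (r : Fin (p + 1) → ℤ) (ε : ℂ) (v : Fin p → S (p + 1)), r i = 0 ∧ ε ≠ 0 ∧
      ∀ α : Ω[S (p + 1)⁄ℂ], wedge (n := p + 1) rfl α (dd v) =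
        (logCoord i α * (ε • mono r)) • vol (p + 1) := by
  -- The functions are the uⱼ with j ≠ i. The monomial u^r is their product, since duⱼ = uⱼ ·
  -- duⱼ/uⱼ, and ε is the sign of the permutation that lists i first and the other indices in order.
  refine ⟨∑ j : Fin p, Pi.single (i.succAbove j) 1,
    ((Equiv.Perm.sign i.cycleRange.symm : ℤˣ) : ℤ),
    fun j => u (i.succAbove j), by simp [Finset.sum_apply], by simp, fun α => ?_⟩
  have hd : (fun j : Fin p => d (p + 1) (u (i.succAbove j))) =
      fun j => mono (Pi.single (i.succAbove j) 1) • dlog (i.succAbove j) := by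
    ext j
    rw [dlog, smul_smul, mono_mul_neg, one_smul]
  have hz : ∀ k, k ≠ i → exteriorPower.ιMulti (S (p + 1)) (p + 1)
      (Matrix.vecCons (dlog k) fun j => dlog (i.succAbove j)) = 0 := by
    intro k hk
    obtain ⟨j, rfl⟩ := Fin.exists_succAbove_eq hk
    exact ιMulti_vecCons_eq_zero (fun j => dlog (i.succAbove j)) j
  have hi : exteriorPower.ιMulti (S (p + 1)) (p + 1)
      (Matrix.vecCons (dlog i) fun j => dlog (i.succAbove j)) =
      Equiv.Perm.sign i.cycleRange.symm • vol (p + 1) := by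
    have := (exteriorPower.ιMulti (S (p + 1)) (p + 1)).map_perm dlog i.cycleRange.symm
    rw [show vol (p + 1) = exteriorPower.ιMulti (S (p + 1)) (p + 1) dlog from rfl, ← this]
    congr 1
    ext k
    refine Fin.cases ?_ (fun j => ?_) k
    · simp
    · simp
  rw [dd, wedge_ιMulti, hd, ιMulti_vecCons_smul, prod_mono]
  conv_lhs => rw [eq_sum_logCoord α]
  rw [ιMulti_vecCons_sum, Finset.sum_eq_single i (fun k _ hk => by rw [hz k hk, smul_zero])
    (by simp), hi, smul_smul, mul_comm, mul_smul_comm, Units.smul_def, ← Int.cast_smul_eq_zsmul ℂ,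
    smul_comm, ← smul_assoc]

/-- The Nᵢ are the maximal minors, with sign, of the exponent matrix (r_j), up to the monomial
factor that is split off. They are orthogonal to Σ r_j, which is in the span of the r_j; this
disposes of the extra Leibniz term in `formLift_wedge_mono`. -/
theorem exists_wedge_dd_mono {p : ℕ} (r : Fin p → Fin (p + 1) → ℤ) :
    ∃ N : Fin (p + 1) → ℂ, (∑ i, ((∑ j, r j) i : ℂ) * N i = 0) ∧
      ∀ α : Ω[S (p + 1)⁄ℂ], volCoef _ (wedge (n := p + 1) rfl α (dd fun j => mono (r j))) =
        ∑ i, logCoord i α * N i • mono (∑ j, r j) := by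
  have key : ∀ α : Ω[S (p + 1)⁄ℂ], wedge (n := p + 1) rfl α (dd fun j => mono (r j)) =
      ∑ i, (logCoord i α * mono (∑ j, r j)) • exteriorPower.ιMulti (S (p + 1)) (p + 1)
        (Matrix.vecCons (dlog i) fun j => logMono _ (r j)) := by
    intro α
    have hd : (fun j : Fin p => d (p + 1) (mono (r j))) =
      fun j => mono (r j) • logMono _ (r j) := funext fun j => d_mono_eq_smul _
    rw [dd, wedge_ιMulti, hd, ιMulti_vecCons_smul, prod_mono]
    conv_lhs => rw [eq_sum_logCoord α]
    rw [ιMulti_vecCons_sum, Finset.smul_sum]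
    exact Finset.sum_congr rfl fun i _ => by rw [smul_smul, mul_comm]
  -- The columns are the coordinates of duᵢ/uᵢ and of the logarithmic differentials of the u^{r_j}.
  let P (i : Fin (p + 1)) : Matrix (Fin (p + 1)) (Fin (p + 1)) ℂ := Matrix.of fun k j =>
    Matrix.vecCons (if k = i then 1 else 0) (fun j => (r j k : ℂ)) j
  have hN (i) : volCoef _ (exteriorPower.ιMulti (S (p + 1)) (p + 1)
      (Matrix.vecCons (dlog i) fun j => logMono _ (r j))) =
        algebraMap ℂ (S (p + 1)) (P i).det := by
    rw [volCoef, exteriorPower.alternatingMapLinearEquiv_apply_ιMulti, Module.Basis.det_apply,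
      RingHom.map_det]
    congr 1
    ext1 k j
    rw [Module.Basis.toMatrix_apply, dlogBasis_repr]
    refine Fin.cases ?_ (fun j => ?_) j
    · simp only [Matrix.cons_val_zero, logCoord_dlog, P, RingHom.mapMatrix_apply,
        Matrix.map_apply, Matrix.of_apply]
      split_ifs
      · exact (map_one _).symm
      · exact (map_zero _).symm
    · simp only [Matrix.cons_val_succ, logCoord_logMono, P, RingHom.mapMatrix_apply,
        Matrix.map_apply, Matrix.of_apply]
  have hvol : ∀ α : Ω[S (p + 1)⁄ℂ],
      volCoef _ (wedge (n := p + 1) rfl α (dd fun j => mono (r j))) =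
        ∑ i, logCoord i α * (P i).det • mono (∑ j, r j) := by
    intro α
    rw [key, map_sum]
    refine Finset.sum_congr rfl fun i _ => ?_
    rw [map_smul, hN, smul_eq_mul, mul_assoc, mul_comm (mono _), Algebra.smul_def]
  refine ⟨fun i => (P i).det, ?_, hvol⟩
  -- The logarithmic differential of ∏ u^{r_j} is a combination of the d(u^{r_j}), so its wedge with
  -- all of them vanishes. Reading this off with `hvol` gives the orthogonality.
  have h0 : wedge (n := p + 1) rfl (logMono _ (∑ j, r j)) (dd fun j => mono (r j)) = 0 := by
    rw [dd, wedge_ιMulti, map_sum]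
    have hd (j) : logMono _ (r j) = mono (-(r j)) • d (p + 1) (mono (r j)) := rfl
    simp only [hd]
    rw [ιMulti_vecCons_sum]
    exact Finset.sum_eq_zero fun j _ => by
      rw [ιMulti_vecCons_eq_zero (fun j => d (p + 1) (mono (r j))) j, smul_zero]
  have h1 := hvol (logMono _ (∑ j, r j))
  rw [h0, map_zero] at h1
  simp only [logCoord_logMono, mul_smul_comm, ← Algebra.smul_def, smul_smul] at h1
  rw [← Finset.sum_smul] at h1
  have h2 := (smul_eq_zero.1 h1.symm).resolve_right ((monoBasis (p + 1)).ne_zero _)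
  rw [← h2]
  exact Finset.sum_congr rfl fun i _ => mul_comm _ _

end Forms

/-! ### Classes of monomials in a twisted quotient -/

section Quotient

variable {n : ℕ} (w : Fin n → ℕ)

theorem logDer_u (i j : Fin n) : logDer i (u j) = if j = i then u i else 0 := by
  rw [u, logDer_mono]
  by_cases h : j = i
  · subst h; simp [u]
  · simp [h, Ne.symm h]

theorem logDer_u₀ (i : Fin n) : logDer i (u₀ w) = (-(w i : ℂ)) • u₀ w := by
  rw [u₀, logDer_mono]; simp

theorem u_mul_mono (i : Fin n) (m : Fin n → ℤ) : u i * mono m = mono (m + Pi.single i 1) := by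
  rw [u, mono_mul, add_comm]

theorem u₀_mul_mono (m : Fin n → ℤ) : u₀ w * mono m = mono (fun i => m i - w i) := by
  rw [u₀, mono_mul]
  congr 1
  ext i
  simp only [Pi.add_apply]; ring

/-- The inverse of `w₁^{w₁} ⋯ wₙ^{wₙ}`. -/
def kappa : ℂ := (∏ i, (w i : ℂ) ^ w i)⁻¹

variable {w} in
theorem kappa_ne_zero (hw : ∀ i, 0 < w i) : kappa w ≠ 0 :=
  inv_ne_zero (Finset.prod_ne_zero_iff.2 fun i _ => pow_ne_zero _ (by
    exact_mod_cast (hw i).ne'))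

variable (B : Type) [CommRing B] [Algebra ℂ B] (xB s t : B)

/-- The quotient of the relative forms of top degree by the image of `s d_u - t d_u F`. -/
abbrev TwistedQuot : Type := RelForms B n n ⧸ twistedRel B xB w s t

/-- The class of `u^m du₁/u₁ ∧ ⋯ ∧ duₙ/uₙ`. -/
def monoClass (m : Fin n → ℤ) : TwistedQuot w B xB s t :=
  (twistedRel B xB w s t).mkQ ((1 : B) ⊗ₜ[ℂ] (mono m • vol n))

theorem dFwedge_tmul {p : ℕ} (h : p + 1 = n) (η : Forms n p) :
    dFwedge B xB w h ((1 : B) ⊗ₜ[ℂ] η) =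
      ∑ i, (1 : B) ⊗ₜ[ℂ] wedge h (d n (u i)) η + xB • ((1 : B) ⊗ₜ[ℂ] wedge h (d n (u₀ w)) η) := by
  simp [dFwedge, wedgeBy]

theorem one_tmul_smul {M : Type} [AddCommGroup M] [Module ℂ M] (z : ℂ) (η : M) :
    (1 : B) ⊗ₜ[ℂ] (z • η) = algebraMap ℂ B z • ((1 : B) ⊗ₜ[ℂ] η) := by
  rw [TensorProduct.tmul_smul, algebraMap_smul]

variable {w} in
theorem relation_mem {p : ℕ} (h : p + 1 = n) (β : S n) (v : Fin p → S n) :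
    s • ((1 : B) ⊗ₜ[ℂ] wedge h (d n β) (dd v)) -
      t • (∑ i, (1 : B) ⊗ₜ[ℂ] wedge h (d n (u i)) (β • dd v) +
        xB • ((1 : B) ⊗ₜ[ℂ] wedge h (d n (u₀ w)) (β • dd v))) ∈ twistedRel B xB w s t :=
  Submodule.subset_span ⟨p, h, β, v, by rw [dFwedge_tmul]⟩

/-- The form β dv₁ ∧ ⋯ ∧ dv_p plays the part of the contraction of u^m vol with uᵢ ∂/∂uᵢ. -/
theorem exists_primitive (m : Fin n → ℤ) (i : Fin n) :
    ∃ (p : ℕ) (h : p + 1 = n) (β : S n) (v : Fin p → S n),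
      wedge h (d n β) (dd v) = (m i : ℂ) • (mono m • vol n) ∧
      ∀ g, wedge h (d n g) (β • dd v) = (logDer i g * mono m) • vol n := by
  obtain _ | p := n
  · exact i.elim0
  obtain ⟨r, ε, v, hri, hε, hv⟩ := exists_wedge_eq_logCoord i
  have hm : ε⁻¹ • mono (m - r) * ε • mono r = mono m := by
    rw [smul_mul_smul_comm, mono_mul, inv_mul_cancel₀ hε, one_smul, sub_add_cancel]
  -- The factor β cancels ε u^r. As rᵢ = 0, uᵢ ∂/∂uᵢ still acts on it by mᵢ.
  refine ⟨p, rfl, ε⁻¹ • mono (m - r), v, ?_, fun g => ?_⟩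
  · rw [hv, logCoord_d, Derivation.map_smul, logDer_mono, smul_comm, smul_mul_assoc, hm]
    simp [hri, smul_assoc]
  · rw [map_smul, hv, logCoord_d, smul_smul, ← hm]
    congr 1
    ring

theorem map_relation {B M Q : Type*} [CommRing B] [AddCommGroup M] [AddCommGroup Q] [Module B M]
    [Module B Q] (π : M →ₗ[B] Q) {s t x α β : B} {y y₁ y₂ : M}
    (h : π (s • α • y - t • (y₁ + x • β • y₂)) = 0) :
    (s * α) • π y = t • (π y₁ - (-β * x) • π y₂) := by
  simp only [map_sub, map_smul, map_add, sub_eq_zero] at h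
  rw [mul_smul, h]
  module

/-- This is s d_u − t d_uF∧ applied to the contraction of u^m vol with uᵢ ∂/∂uᵢ; here uᵢ ∂F/∂uᵢ = uᵢ
− wᵢ x u₀. -/
theorem monoClass_relation (m : Fin n → ℤ) (i : Fin n) :
    (s * algebraMap ℂ B (m i)) • monoClass w B xB s t m =
      t • (monoClass w B xB s t (m + Pi.single i 1) -
        (algebraMap ℂ B (w i) * xB) • monoClass w B xB s t (fun i => m i - w i)) := by
  obtain ⟨p, h, β, v, h1, h2⟩ := exists_primitive m i
  have hmem := relation_mem (w := w) B xB s t h β v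
  have h3 : ∑ j, (1 : B) ⊗ₜ[ℂ] wedge h (d n (u j)) (β • dd v) =
      (1 : B) ⊗ₜ[ℂ] (mono (m + Pi.single i 1) • vol n) := by
    rw [Finset.sum_eq_single i]
    · rw [h2, logDer_u, if_pos rfl, u_mul_mono]
    · intro j _ hj
      rw [h2, logDer_u, if_neg hj, zero_mul, zero_smul, TensorProduct.tmul_zero]
    · simp
  have h4 : (1 : B) ⊗ₜ[ℂ] wedge h (d n (u₀ w)) (β • dd v) =
      algebraMap ℂ B (-w i) • (1 : B) ⊗ₜ[ℂ] (mono (fun i => m i - w i) • vol n) := by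
    rw [h2, logDer_u₀, smul_mul_assoc, u₀_mul_mono, smul_assoc, one_tmul_smul]
  rw [h1, h3, h4, one_tmul_smul] at hmem
  refine (map_relation (twistedRel B xB w s t).mkQ ((Submodule.Quotient.mk_eq_zero _).2 hmem)).trans
    ?_
  rw [map_neg, neg_neg]
  rfl

theorem submodule_eq_top_of_monoClass_mem (P : Submodule B (TwistedQuot w B xB s t))
    (hP : ∀ m, monoClass w B xB s t m ∈ P) : P = ⊤ := by
  rw [eq_top_iff]
  rintro y -
  obtain ⟨z, rfl⟩ := (twistedRel B xB w s t).mkQ_surjective y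
  induction z using TensorProduct.induction_on with
  | zero => simp
  | add y z hy hz => rw [map_add]; exact add_mem hy hz
  | tmul β η =>
    rw [← volCoef_smul_vol η, ← mul_one β, ← smul_eq_mul, ← TensorProduct.smul_tmul', map_smul]
    refine P.smul_mem _ ?_
    generalize volCoef n η = g
    induction (monoBasis n).mem_span g using Submodule.span_induction with
    | zero => simp
    | add y z _ _ hy hz => rw [add_smul, TensorProduct.tmul_add, map_add]; exact add_mem hy hz
    | smul z g _ hg =>
      rw [smul_assoc, one_tmul_smul, map_smul]
      exact P.smul_mem _ hg
    | mem g hg =>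
      obtain ⟨m, rfl⟩ := hg
      exact hP m

/-! ### The classes of v^b and their relations -/

/-- The exponent of `u^m` in `v^b`, where `v₀ = x u₀` and `vᵢ = uᵢ / wᵢ`. -/
def toricExp (b : Fin (n + 1) → ℕ) : Fin n → ℤ := fun i => b i.succ - w i * b 0

theorem toricExp_add_succ (b : Fin (n + 1) → ℕ) (i : Fin n) :
    toricExp w (b + Pi.single i.succ 1) = toricExp w b + Pi.single i 1 := by
  ext j
  simp only [toricExp, Pi.add_apply, Pi.single_apply, Fin.succ_inj, (Fin.succ_ne_zero i).symm,
    if_false]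
  push_cast
  split_ifs <;> ring

theorem toricExp_add_zero (b : Fin (n + 1) → ℕ) :
    toricExp w (b + Pi.single 0 1) = fun j => toricExp w b j - w j := by
  ext j
  simp only [toricExp, Pi.add_apply, Pi.single_apply, Fin.succ_ne_zero, if_false, if_true]
  push_cast
  ring

theorem toricExp_add_W (b : Fin (n + 1) → ℕ) : toricExp w (b + W w) = toricExp w b := by
  ext j
  simp only [toricExp, Pi.add_apply, W_zero, W_succ]
  push_cast
  ring

variable {w} in
theorem toricExp_surjective (hw : ∀ i, 0 < w i) : Function.Surjective (toricExp w) := by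
  intro m
  -- With b₀ = N the required bᵢ = mᵢ + wᵢ N are nonnegative, because wᵢ ≥ 1.
  let N : ℕ := ∑ i, (m i).natAbs
  have hN (i) : 0 ≤ m i + w i * N := by
    have h1 : (m i).natAbs ≤ N :=
      Finset.single_le_sum (f := fun i => (m i).natAbs) (fun _ _ => Nat.zero_le _)
        (Finset.mem_univ i)
    have h2 : N ≤ w i * N := Nat.le_mul_of_pos_left _ (hw i)
    have h3 : ((w i * N : ℕ) : ℤ) = w i * N := by push_cast; rfl
    omega
  refine ⟨Fin.cons N fun i => (m i + w i * N).toNat, ?_⟩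
  ext i
  simp [toricExp, hN]

/-- As w₀ = 1, the integral relations among the exponents of the vᵢ are the multiples of W, and the
multiple is read off from the coordinate 0. -/
theorem eq_add_of_toricExp_eq {b b' : Fin (n + 1) → ℕ} (h : toricExp w b = toricExp w b')
    (h0 : b 0 ≤ b' 0) : b' = b + (b' 0 - b 0) • W w := by
  ext i
  refine Fin.cases ?_ (fun i => ?_) i
  · simp [h0]
  · obtain ⟨q, hq⟩ := Nat.exists_eq_add_of_le h0
    have := congrFun h i
    simp only [toricExp, hq, Nat.cast_add] at this
    have h2 : (b' i.succ : ℤ) = (b i.succ + q * w i : ℕ) := by push_cast; linarith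
    simpa [hq] using Nat.cast_injective h2

/-- The class of `v^b`, where `v₀ = x u₀` and `vᵢ = uᵢ / wᵢ`. -/
def vClass (b : Fin (n + 1) → ℕ) : TwistedQuot w B xB s t :=
  (xB ^ b 0 * algebraMap ℂ B (∏ i : Fin n, (w i : ℂ) ^ b i.succ)⁻¹) •
    monoClass w B xB s t (toricExp w b)

variable {w}

theorem vClass_add_succ (hw : ∀ i, 0 < w i) (b : Fin (n + 1) → ℕ) (i : Fin n) :
    algebraMap ℂ B (w i) • vClass w B xB s t (b + Pi.single i.succ 1) =
      (xB ^ b 0 * algebraMap ℂ B (∏ i : Fin n, (w i : ℂ) ^ b i.succ)⁻¹) •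
        monoClass w B xB s t (toricExp w b + Pi.single i 1) := by
  have hwi : (w i : ℂ) ≠ 0 := by exact_mod_cast (hw i).ne'
  have hb (j : Fin n) : (b + Pi.single i.succ 1 : Fin (n + 1) → ℕ) j.succ =
        b j.succ + if j = i then 1 else 0 := by
    simp [Pi.single_apply]
  have h0 : (b + Pi.single i.succ 1 : Fin (n + 1) → ℕ) 0 = b 0 := by simp
  rw [vClass, smul_smul, h0]
  congr 1
  · rw [mul_left_comm, ← map_mul]
    congr 2
    simp only [hb, pow_add, Finset.prod_mul_distrib, pow_ite, pow_one, pow_zero,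
      Finset.prod_ite_eq', Finset.mem_univ, if_true]
    field_simp
  · rw [toricExp_add_succ]

theorem vClass_add_zero (b : Fin (n + 1) → ℕ) :
    vClass w B xB s t (b + Pi.single 0 1) =
      (xB ^ b 0 * algebraMap ℂ B (∏ i : Fin n, (w i : ℂ) ^ b i.succ)⁻¹ * xB) •
        monoClass w B xB s t (fun i => toricExp w b i - w i) := by
  rw [vClass]
  congr 1
  · simp [pow_succ]; ring
  · rw [toricExp_add_zero]

variable {s t} {θB : B}

/-- Dividing uᵢ by wᵢ makes the two terms of `monoClass_relation` enter with coefficients 1 and −1.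
The form s = tθ with t a unit covers both G₀, where (s, t) = (θ, 1), and G, where (s, t) = (1, τ).
-/
theorem vClass_add_sub_zero (hw : ∀ i, 0 < w i) (ht : IsUnit t) (hs : s = t * θB)
    (b : Fin (n + 1) → ℕ) (i : Fin (n + 1)) :
    vClass w B xB s t (b + Pi.single i 1) - vClass w B xB s t (b + Pi.single 0 1) =
      (θB * algebraMap ℂ B (b i / W w i - b 0)) • vClass w B xB s t b := by
  refine Fin.cases (by simp) (fun i => ?_) i
  have hwi : (w i : ℂ) ≠ 0 := by exact_mod_cast (hw i).ne'
  have hu : IsUnit (algebraMap ℂ B (w i)) := (IsUnit.mk0 _ hwi).map _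
  have h1 := vClass_add_succ B xB s t hw b i
  have h2 := monoClass_relation w B xB s t (toricExp w b) i
  subst hs
  rw [mul_assoc, mul_smul, ht.smul_left_cancel] at h2
  rw [← hu.smul_left_cancel, smul_sub, h1, vClass_add_zero, vClass]
  rw [eq_sub_iff_add_eq] at h2
  rw [← h2]
  have h3 : algebraMap ℂ B (w i) * algebraMap ℂ B (b i.succ / W w i.succ - b 0) =
      algebraMap ℂ B (toricExp w b i) := by
    rw [← map_mul]
    congr 1
    rw [W_succ, toricExp]
    push_cast
    field_simp
  simp only [smul_add, smul_smul, ← h3]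
  module

theorem vClass_add_sub (hw : ∀ i, 0 < w i) (ht : IsUnit t) (hs : s = t * θB)
    (b : Fin (n + 1) → ℕ) (i j : Fin (n + 1)) :
    vClass w B xB s t (b + Pi.single i 1) - vClass w B xB s t (b + Pi.single j 1) =
      (θB * algebraMap ℂ B (b i / W w i - b j / W w j)) • vClass w B xB s t b := by
  rw [← sub_sub_sub_cancel_right _ _ (vClass w B xB s t (b + Pi.single 0 1)),
    vClass_add_sub_zero B xB hw ht hs, vClass_add_sub_zero B xB hw ht hs, ← sub_smul, ← mul_sub,
    ← map_sub, sub_sub_sub_cancel_right]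

variable (s t)

theorem vClass_add_W (b : Fin (n + 1) → ℕ) :
    vClass w B xB s t (b + W w) = (algebraMap ℂ B (kappa w) * xB) • vClass w B xB s t b := by
  rw [vClass, vClass, smul_smul]
  congr 1
  · simp only [Pi.add_apply, W_zero, W_succ, pow_add, Finset.prod_mul_distrib, mul_inv, map_mul,
      kappa]
    ring
  · rw [toricExp_add_W]

theorem vClass_add_nsmul_W (b : Fin (n + 1) → ℕ) (q : ℕ) :
    vClass w B xB s t (b + q • W w) =
      (algebraMap ℂ B (kappa w) * xB) ^ q • vClass w B xB s t b := by
  induction q with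
  | zero => simp
  | succ q ih => rw [succ_nsmul, ← add_assoc, vClass_add_W, ih, smul_smul, pow_succ']

variable {s t}

/-- Modulo smaller degree, a unit of the exponent can be moved from any positive index to the index
0; repeating this leads to v₀^k. -/
theorem vClass_mem_of_degree_eq (hw : ∀ i, 0 < w i) (ht : IsUnit t) (hs : s = t * θB)
    (P : Submodule B (TwistedQuot w B xB s t)) (k : ℕ)
    (ih : ∀ b : Fin (n + 1) → ℕ, ∑ i, b i < k → vClass w B xB s t b ∈ P)
    (b : Fin (n + 1) → ℕ) (hb : ∑ i, b i = k) :
    vClass w B xB s t b ∈ P ↔ vClass w B xB s t (Pi.single 0 k) ∈ P := by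
  induction hl : ∑ i : Fin n, b i.succ generalizing b with
  | zero =>
    have : b = Pi.single 0 k := by
      rw [Fin.sum_univ_succ, hl, add_zero] at hb
      rw [Finset.sum_eq_zero_iff] at hl
      ext i
      refine Fin.cases (by simp [hb]) (fun i => by simpa using hl i (Finset.mem_univ i)) i
    rw [this]
  | succ l ihl =>
    obtain ⟨i, -, hi⟩ : ∃ i ∈ Finset.univ, b (Fin.succ i) ≠ 0 :=
      Finset.exists_ne_zero_of_sum_ne_zero (by rw [hl]; exact l.succ_ne_zero)
    obtain ⟨b', rfl⟩ : ∃ b' : Fin (n + 1) → ℕ, b = b' + Pi.single i.succ 1 := by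
      refine ⟨b - Pi.single i.succ 1, ?_⟩
      rw [tsub_add_cancel_of_le]
      intro j
      by_cases hj : j = i.succ
      · subst hj; simpa using Nat.one_le_iff_ne_zero.2 hi
      · simp [hj]
    have hl' : ∑ i : Fin n, b' i.succ = l := by
      simp only [Pi.add_apply, Finset.sum_add_distrib, Pi.single_apply,
        (Fin.succ_injective n).eq_iff, Finset.sum_ite_eq', Finset.mem_univ, if_true] at hl
      omega
    have hb' : ∑ i, b' i + 1 = k := by
      simpa [Finset.sum_add_distrib] using hb
    have h1 := vClass_add_sub_zero B xB hw ht hs b' i.succ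
    have h2 := P.smul_mem (θB * algebraMap ℂ B (b' i.succ / W w i.succ - b' 0))
      (ih b' (by omega))
    rw [← ihl (b' + Pi.single 0 1) (by simpa [Finset.sum_add_distrib] using hb')
      (by simpa using hl')]
    rw [← h1] at h2
    exact ⟨fun h => by simpa using P.sub_mem h h2, fun h => by simpa using P.add_mem h2 h⟩

theorem vClass_mem_span (hw : ∀ i, 0 < w i) (ht : IsUnit t) (hs : s = t * θB)
    (b : Fin (n + 1) → ℕ) :
    vClass w B xB s t b ∈
      Submodule.span B (Set.range fun k : Fin (mu w) => vClass w B xB s t (a w k)) := by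
  induction hk : ∑ i, b i using Nat.strong_induction_on generalizing b with
  | _ k ih =>
    have ih' := fun b' hb' => ih _ hb' b' rfl
    rw [vClass_mem_of_degree_eq B xB hw ht hs _ k ih' b hk,
      -- Among the exponents of degree k, this one has class (κx)^{k/μ} times a generator.
      ← vClass_mem_of_degree_eq B xB hw ht hs _ k ih' (a w (k % mu w) + (k / mu w) • W w),
      vClass_add_nsmul_W]
    · exact Submodule.smul_mem _ _ (Submodule.subset_span
        ⟨⟨k % mu w, Nat.mod_lt _ mu_pos⟩, rfl⟩)
    · simp only [Pi.add_apply, Finset.sum_add_distrib, sum_a, Pi.smul_apply, ← Finset.smul_sum]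
      exact Nat.mod_add_div' k (mu w)

theorem monoClass_eq_smul_vClass (hw : ∀ i, 0 < w i) (hx : IsUnit xB) (m : Fin n → ℤ) :
    ∃ (z : B) (b : Fin (n + 1) → ℕ), monoClass w B xB s t m = z • vClass w B xB s t b := by
  obtain ⟨b, rfl⟩ := toricExp_surjective hw m
  have hu : IsUnit (xB ^ b 0 * algebraMap ℂ B (∏ i : Fin n, (w i : ℂ) ^ b i.succ)⁻¹) := by
    refine (hx.pow _).mul (IsUnit.map _ (IsUnit.mk0 _ (inv_ne_zero ?_)))
    exact Finset.prod_ne_zero_iff.2 fun i _ => pow_ne_zero _ (by exact_mod_cast (hw i).ne')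
  refine ⟨(hu.unit⁻¹ : Bˣ), b, ?_⟩
  rw [vClass, smul_smul, IsUnit.val_inv_mul, one_smul]

theorem span_vClass_eq_top (hw : ∀ i, 0 < w i) (hx : IsUnit xB) (ht : IsUnit t)
    (hs : s = t * θB) :
    Submodule.span B (Set.range fun k : Fin (mu w) => vClass w B xB s t (a w k)) = ⊤ := by
  refine submodule_eq_top_of_monoClass_mem w B xB s t _ fun m => ?_
  obtain ⟨z, b, h⟩ := monoClass_eq_smul_vClass (s := s) (t := t) B xB hw hx m
  rw [h]
  exact Submodule.smul_mem _ _ (vClass_mem_span B xB hw ht hs b)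

end Quotient

/-! ### Linear independence -/

section Independence

/-- The value at b is the product of all T i k with k < b i, applied to v; commutativity makes the
order of the factors irrelevant. -/
theorem exists_of_commute {ι M : Type*} [Fintype ι] [DecidableEq ι] [AddCommGroup M] [Module ℂ M]
    (T : ι → ℕ → Module.End ℂ M) (hT : ∀ i k j l, T i k * T j l = T j l * T i k) (v : M) :
    ∃ f : (ι → ℕ) → M, f 0 = v ∧ ∀ b i, f (b + Pi.single i 1) = T i (b i) (f b) := by
  let s : Set (Module.End ℂ M) := Set.range fun p : ι × ℕ => T p.1 p.2
  have hs : ∀ P ∈ s, ∀ Q ∈ s, P * Q = Q * P := by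
    rintro _ ⟨p, rfl⟩ _ ⟨q, rfl⟩
    exact hT _ _ _ _
  -- The products are taken in the subalgebra generated by the operators, which is commutative.
  have hcomm := Algebra.isMulCommutative_adjoin ℂ hs
  let _ : CommRing (Algebra.adjoin ℂ s) := { mul_comm := hcomm.is_comm.comm }
  let τ (i : ι) (k : ℕ) : Algebra.adjoin ℂ s := ⟨T i k, Algebra.subset_adjoin ⟨(i, k), rfl⟩⟩
  let P (b : ι → ℕ) : Algebra.adjoin ℂ s := ∏ i, ∏ k ∈ Finset.range (b i), τ i k
  have hP (b i) : P (b + Pi.single i 1) = τ i (b i) * P b := by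
    simp only [P]
    rw [← Finset.mul_prod_erase _ _ (Finset.mem_univ i),
      ← Finset.mul_prod_erase (a := i) Finset.univ (fun i => ∏ k ∈ Finset.range (b i), _)
        (Finset.mem_univ i), ← mul_assoc]
    congr 1
    · simp only [Pi.add_apply, Pi.single_eq_same, Finset.prod_range_succ]
      exact mul_comm _ _
    · exact Finset.prod_congr rfl fun j hj => by simp [Finset.ne_of_mem_erase hj]
  refine ⟨fun b => (P b : Module.End ℂ M) v, ?_, fun b i => ?_⟩
  · have h0 : P 0 = 1 := by simp [P]
    change (P 0 : Module.End ℂ M) v = v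
    rw [h0]
    rfl
  · change (P (b + Pi.single i 1) : Module.End ℂ M) v = _
    rw [hP]
    rfl

theorem add_single_induction {ι : Type*} [Fintype ι] [DecidableEq ι] {P : (ι → ℕ) → Prop}
    (zero : P 0) (add : ∀ b i, P b → P (b + Pi.single i 1)) (b : ι → ℕ) : P b := by
  induction hk : ∑ i, b i generalizing b with
  | zero =>
    have : b = 0 := funext fun i => by
      simpa using (Finset.sum_eq_zero_iff.1 hk) i (Finset.mem_univ i)
    exact this ▸ zero
  | succ k ih =>
    obtain ⟨i, -, hi⟩ : ∃ i ∈ Finset.univ, b i ≠ 0 :=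
      Finset.exists_ne_zero_of_sum_ne_zero (by rw [hk]; exact k.succ_ne_zero)
    have hb : b - Pi.single i 1 + Pi.single i 1 = b := by
      rw [tsub_add_cancel_of_le]
      intro j
      by_cases hj : j = i
      · subst hj; simpa using Nat.one_le_iff_ne_zero.2 hi
      · simp [hj]
    rw [← hb] at hk ⊢
    exact add _ i (ih _ (by simpa [Finset.sum_add_distrib] using hk))

variable {n : ℕ} (w : Fin n → ℕ) (B : Type) [CommRing B] [Algebra ℂ B] (xB θB : B)
  (δ : Derivation ℂ B B)

/-- The standard basis vector `e_k` for `k < μ`, and `κ x e₀` otherwise. -/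
def modelVec (k : ℕ) : Fin (mu w) → B :=
  if h : k < mu w then Pi.single ⟨k, h⟩ 1
  else (algebraMap ℂ B (kappa w) * xB) • Pi.single ⟨0, mu_pos⟩ 1

/-- The operator on `B^μ` which corresponds to `-θ x ∇_{∂_x}`. -/
def modelOp : Module.End ℂ (Fin (mu w) → B) where
  toFun v := ∑ k : Fin (mu w), v k • (modelVec w B xB (k + 1) -
    (θB * algebraMap ℂ B (slope w k)) • modelVec w B xB k) - θB • fun k => δ (v k)
  map_add' v v' := by
    have : (fun k => δ ((v + v') k)) = (fun k => δ (v k)) + fun k => δ (v' k) := by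
      ext; simp
    rw [this, smul_add]
    simp only [Pi.add_apply, add_smul, Finset.sum_add_distrib]
    abel
  map_smul' z v := by
    have : (fun k => δ ((z • v) k)) = z • fun k => δ (v k) := by
      ext; simp
    rw [this, smul_comm θB z]
    simp only [Pi.smul_apply, smul_assoc, ← Finset.smul_sum, RingHom.id_apply]
    rw [← smul_sub]

theorem modelOp_apply (v : Fin (mu w) → B) : modelOp w B xB θB δ v =
    ∑ k : Fin (mu w), v k • (modelVec w B xB (k + 1) -
      (θB * algebraMap ℂ B (slope w k)) • modelVec w B xB k) - θB • fun k => δ (v k) := rfl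

/-- The operator is not B-linear: it obeys the Leibniz rule for −θδ, where δ stands for x ∂/∂x. -/
theorem modelOp_smul (β : B) (v : Fin (mu w) → B) :
    modelOp w B xB θB δ (β • v) = β • modelOp w B xB θB δ v - (θB * δ β) • v := by
  have : (fun k => δ ((β • v) k)) = β • (fun k => δ (v k)) + δ β • v := by
    ext k; simp [mul_comm]
  rw [modelOp_apply, this]
  simp only [modelOp_apply, Pi.smul_apply, smul_assoc, ← Finset.smul_sum]
  module

theorem modelOp_modelVec {k : ℕ} (hk : k < mu w) :
    modelOp w B xB θB δ (modelVec w B xB k) =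
      modelVec w B xB (k + 1) - (θB * algebraMap ℂ B (slope w k)) • modelVec w B xB k := by
  have h : modelVec w B xB k = Pi.single ⟨k, hk⟩ 1 := dif_pos hk
  have h0 : (fun j => δ (modelVec w B xB k j)) = 0 := by
    ext j
    rw [h]
    by_cases hj : j = ⟨k, hk⟩
    · subst hj; simp
    · simp [hj]
  rw [modelOp_apply, h0, smul_zero, sub_zero, Finset.sum_eq_single ⟨k, hk⟩]
  · rw [h]; simp
  · intro j _ hj
    rw [h]; simp [hj]
  · simp

variable {w B xB θB δ}

/-- Since δθ = 0, multiplication by θ and by constants commutes with the model operator, so all the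
operators D + θ q commute with each other. -/
theorem exists_modelFun (hθ : δ θB = 0) :
    ∃ f : (Fin (n + 1) → ℕ) → Fin (mu w) → B, f 0 = modelVec w B xB 0 ∧
      ∀ b i, f (b + Pi.single i 1) =
        modelOp w B xB θB δ (f b) + (θB * algebraMap ℂ B (b i / W w i)) • f b := by
  let Θ (z : ℂ) : Module.End ℂ (Fin (mu w) → B) :=
    (LinearMap.lsmul B (Fin (mu w) → B) (θB * algebraMap ℂ B z)).restrictScalars ℂ
  have h1 (z) : modelOp w B xB θB δ * Θ z = Θ z * modelOp w B xB θB δ := by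
    refine LinearMap.ext fun v => ?_
    have h2 : δ (θB * algebraMap ℂ B z) = 0 := by simp [hθ]
    change modelOp w B xB θB δ ((θB * algebraMap ℂ B z) • v) =
      (θB * algebraMap ℂ B z) • modelOp w B xB θB δ v
    rw [modelOp_smul, h2, mul_zero, zero_smul, sub_zero]
  have h3 (z z') : Θ z * Θ z' = Θ z' * Θ z := by
    refine LinearMap.ext fun v => ?_
    exact smul_comm (θB * algebraMap ℂ B z) (θB * algebraMap ℂ B z') v
  exact exists_of_commute (fun (i : Fin (n + 1)) (k : ℕ) => modelOp w B xB θB δ + Θ (k / W w i))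
    (fun i k j l => by simp only [mul_add, add_mul, h1, h3 (k / W w i)]; abel) _

variable {f : (Fin (n + 1) → ℕ) → Fin (mu w) → B}

/-- Along a(k) the term θ b_i/w_i is θ times the slope and cancels the correction in D e_k. The case
k = μ is included and gives κ x e₀. -/
theorem modelFun_a (h0 : f 0 = modelVec w B xB 0)
    (hf : ∀ b i, f (b + Pi.single i 1) =
      modelOp w B xB θB δ (f b) + (θB * algebraMap ℂ B (b i / W w i)) • f b)
    {k : ℕ} (hk : k ≤ mu w) : f (a w k) = modelVec w B xB k := by
  induction k with
  | zero => exact h0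
  | succ k ih =>
    rw [a_succ, hf, ih (by omega), modelOp_modelVec w B xB θB δ (by omega)]
    simp [slope]

/-- The base case is a(μ) = W. In the induction two terms cancel: adding W raises b_i/w_i by 1,
which contributes +θ, and moving D past κx contributes −θ because δ(κx) = κx. -/
theorem modelFun_add_W (hw : ∀ i, 0 < w i) (hx : δ xB = xB) (h0 : f 0 = modelVec w B xB 0)
    (hf : ∀ b i, f (b + Pi.single i 1) =
      modelOp w B xB θB δ (f b) + (θB * algebraMap ℂ B (b i / W w i)) • f b)
    (b : Fin (n + 1) → ℕ) : f (b + W w) = (algebraMap ℂ B (kappa w) * xB) • f b := by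
  induction b using add_single_induction with
  | zero =>
    rw [zero_add, ← a_mu hw, modelFun_a h0 hf le_rfl, h0, modelVec, modelVec,
      dif_neg (lt_irrefl _), dif_pos mu_pos]
  | add b i ih =>
    have hδ : δ (algebraMap ℂ B (kappa w) * xB) = algebraMap ℂ B (kappa w) * xB := by
      simp [hx]
    have hW : (W w i : ℂ) ≠ 0 := by exact_mod_cast (W_pos hw i).ne'
    have hz : algebraMap ℂ B (((b + W w) i : ℕ) / W w i) = algebraMap ℂ B (b i / W w i) + 1 := by
      rw [← map_one (algebraMap ℂ B), ← map_add, Pi.add_apply]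
      congr 1
      push_cast
      field_simp
    rw [add_right_comm, hf, ih, modelOp_smul, hδ, hf, hz]
    module

/-! ### From the exponents b to Laurent monomials -/

variable (w) in
/-- The complex number `w₁^{m₁} ⋯ wₙ^{mₙ}`. -/
def wPow (m : Fin n → ℤ) : ℂ := ∏ i, (w i : ℂ) ^ m i

theorem wPow_add_single (hw : ∀ i, 0 < w i) (m : Fin n → ℤ) (i : Fin n) :
    wPow w (m + Pi.single i 1) = wPow w m * w i := by
  have hwi (i) : (w i : ℂ) ≠ 0 := by exact_mod_cast (hw i).ne'
  simp only [wPow, Pi.add_apply, zpow_add₀ (hwi _), Finset.prod_mul_distrib, Pi.single_apply]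
  congr 1
  rw [Finset.prod_eq_single i (fun j _ hj => by simp [hj]) (by simp)]
  simp

theorem wPow_sub (hw : ∀ i, 0 < w i) (m : Fin n → ℤ) :
    wPow w (fun i => m i - w i) = wPow w m * kappa w := by
  have hwi (i) : (w i : ℂ) ≠ 0 := by exact_mod_cast (hw i).ne'
  simp only [wPow, zpow_sub₀ (hwi _), Finset.prod_div_distrib, kappa, zpow_natCast]
  rw [div_eq_mul_inv]

theorem wPow_toricExp (hw : ∀ i, 0 < w i) (b : Fin (n + 1) → ℕ) :
    wPow w (toricExp w b) = (∏ i : Fin n, (w i : ℂ) ^ b i.succ) * kappa w ^ b 0 := by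
  have hwi (i) : (w i : ℂ) ≠ 0 := by exact_mod_cast (hw i).ne'
  simp only [wPow, toricExp, zpow_sub₀ (hwi _), Finset.prod_div_distrib, kappa, zpow_natCast,
    zpow_mul, inv_pow, Finset.prod_pow]
  rw [div_eq_mul_inv]

/-- From v^b = x^{b₀} ∏ wᵢ^{-bᵢ} u^m one gets u^m = ∏ wᵢ^{mᵢ} (κx)^{-b₀} v^b. With y = (κx)⁻¹, the
vector y^{b₀} f(b) does not change under b ↦ b + W, so the right side depends on m only. -/
theorem exists_modelMono (hw : ∀ i, 0 < w i) {y : B}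
    (hy : y * (algebraMap ℂ B (kappa w) * xB) = 1)
    (hf : ∀ b, f (b + W w) = (algebraMap ℂ B (kappa w) * xB) • f b) :
    ∃ g : (Fin n → ℤ) → Fin (mu w) → B, ∀ b,
      g (toricExp w b) = (algebraMap ℂ B (wPow w (toricExp w b)) * y ^ b 0) • f b := by
  have h1 (b) (q : ℕ) : f (b + q • W w) = (algebraMap ℂ B (kappa w) * xB) ^ q • f b := by
    induction q with
    | zero => simp
    | succ q ih => rw [succ_nsmul, ← add_assoc, hf, ih, smul_smul, pow_succ']
  have h2 (b) (q : ℕ) : y ^ (b + q • W w) 0 • f (b + q • W w) = y ^ b 0 • f b := by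
    rw [h1, smul_smul, Pi.add_apply, Pi.smul_apply, W_zero, smul_eq_mul, mul_one, pow_add,
      mul_assoc, ← mul_pow, hy, one_pow, mul_one]
  have h3 (b b') (h : toricExp w b = toricExp w b') : y ^ b 0 • f b = y ^ b' 0 • f b' := by
    rcases le_total (b 0) (b' 0) with h0 | h0
    · rw [eq_add_of_toricExp_eq w h h0, h2]
    · rw [eq_add_of_toricExp_eq w h.symm h0, h2]
  choose σ hσ using toricExp_surjective hw
  refine ⟨fun m => (algebraMap ℂ B (wPow w m) * y ^ σ m 0) • f (σ m), fun b => ?_⟩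
  simp only [mul_smul]
  rw [h3 _ _ (hσ (toricExp w b))]

/-- In f(b + 1_i) − f(b + 1_0) the operator D drops out, and θ (bᵢ/wᵢ − b₀) f(b) = θ (mᵢ/wᵢ) f(b) is
left. -/
theorem modelMono_relation (hw : ∀ i, 0 < w i) {y : B}
    (hy : y * (algebraMap ℂ B (kappa w) * xB) = 1)
    (hf : ∀ b i, f (b + Pi.single i 1) =
      modelOp w B xB θB δ (f b) + (θB * algebraMap ℂ B (b i / W w i)) • f b)
    {g : (Fin n → ℤ) → Fin (mu w) → B} (hg : ∀ b,
      g (toricExp w b) = (algebraMap ℂ B (wPow w (toricExp w b)) * y ^ b 0) • f b)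
    (m : Fin n → ℤ) (i : Fin n) :
    g (m + Pi.single i 1) - (algebraMap ℂ B (w i) * xB) • g (fun i => m i - w i) =
      (θB * algebraMap ℂ B (m i)) • g m := by
  have hwi : (w i : ℂ) ≠ 0 := by exact_mod_cast (hw i).ne'
  obtain ⟨b, rfl⟩ := toricExp_surjective hw m
  rw [← toricExp_add_succ, ← toricExp_add_zero, hg, hg, hg, toricExp_add_succ, toricExp_add_zero,
    wPow_add_single hw, wPow_sub hw, hf, hf]
  have h1 : algebraMap ℂ B (toricExp w b i) =
      algebraMap ℂ B (w i) * (algebraMap ℂ B (b i.succ / w i) - algebraMap ℂ B (b 0)) := by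
    rw [← map_sub, ← map_mul]
    congr 1
    simp only [toricExp]
    push_cast
    field_simp
  have h2 : (b + Pi.single i.succ 1 : Fin (n + 1) → ℕ) 0 = b 0 := by simp
  have h3 : (b + Pi.single 0 1 : Fin (n + 1) → ℕ) 0 = b 0 + 1 := by simp
  have h4 : (algebraMap ℂ B (w i) * xB) * (algebraMap ℂ B (wPow w (toricExp w b) * kappa w) *
      y ^ (b 0 + 1)) = algebraMap ℂ B (wPow w (toricExp w b) * w i) * y ^ b 0 := by
    simp only [map_mul, pow_succ]
    linear_combination (algebraMap ℂ B (w i) * algebraMap ℂ B (wPow w (toricExp w b)) *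
      y ^ b 0) * hy
  rw [h1, h2, h3, smul_smul, h4, map_mul]
  simp only [W_succ, W_zero, Nat.cast_one, div_one]
  module

end Independence

/-! ### Functionals on top forms that kill the relations -/

section Functional

variable {n : ℕ} {w : Fin n → ℕ} {B : Type} [CommRing B] [Algebra ℂ B] {xB θB s t : B}
  {M : Type} [AddCommGroup M] [Module ℂ M] [Module B M] [IsScalarTower ℂ B M]

variable (B) in
/-- The `B`-linear functional on relative forms of top degree with `u^m vol ↦ g(m)`. -/
def formLift (g : (Fin n → ℤ) → M) : RelForms B n n →ₗ[B] M :=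
  ((monoBasis n).constr ℂ g ∘ₗ (volCoef n).restrictScalars ℂ).liftBaseChange B

theorem formLift_tmul (g : (Fin n → ℤ) → M) (η : Forms n n) :
    formLift B g ((1 : B) ⊗ₜ[ℂ] η) = (monoBasis n).constr ℂ g (volCoef n η) := by
  simp [formLift]

theorem formLift_mono (g : (Fin n → ℤ) → M) (m : Fin n → ℤ) :
    formLift B g ((1 : B) ⊗ₜ[ℂ] (mono m • vol n)) = g m := by
  rw [formLift_tmul, map_smul, volCoef_vol, smul_eq_mul, mul_one, ← monoBasis_apply,
    Module.Basis.constr_basis]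

theorem constr_relation {g : (Fin n → ℤ) → M} (hs : s = t * θB)
    (hg : ∀ m i, g (m + Pi.single i 1) - (algebraMap ℂ B (w i) * xB) • g (fun i => m i - w i) =
      (θB * algebraMap ℂ B (m i)) • g m) (i : Fin n) (β : S n) :
    s • (monoBasis n).constr ℂ g (logDer i β) =
      t • ((monoBasis n).constr ℂ g (u i * β) -
        (algebraMap ℂ B (w i) * xB) • (monoBasis n).constr ℂ g (u₀ w * β)) := by
  induction (monoBasis n).mem_span β using Submodule.span_induction with
  | zero => simp
  | add y z _ _ hy hz =>
    rw [map_add, map_add, smul_add, hy, hz, mul_add, mul_add, map_add, map_add]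
    module
  | smul z y _ hy =>
    rw [Derivation.map_smul, mul_smul_comm, mul_smul_comm, map_smul, map_smul, map_smul,
      ← algebraMap_smul B z, ← algebraMap_smul B z, ← algebraMap_smul B z, smul_comm, hy]
    module
  | mem y hy =>
    obtain ⟨m, rfl⟩ := hy
    have h (m) : (monoBasis n).constr ℂ g (mono m) = g m := by
      rw [← monoBasis_apply, Module.Basis.constr_basis]
    rw [monoBasis_apply, logDer_mono, u_mul_mono, u₀_mul_mono, map_smul, h, h, h, hg, hs,
      ← algebraMap_smul B (_ : ℂ)]
    module

/-- By `exists_wedge_dd_mono` this is the combination, with coefficients Nᵢ, of the coordinate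
relations for β u^σ, where σ = Σ r_j. The Leibniz rule adds multiples of σᵢ Nᵢ, whose sum is 0. -/
theorem formLift_wedge_mono {p : ℕ} {w : Fin (p + 1) → ℕ} {g : (Fin (p + 1) → ℤ) → M}
    (hs : s = t * θB)
    (hg : ∀ m i, g (m + Pi.single i 1) - (algebraMap ℂ B (w i) * xB) • g (fun i => m i - w i) =
      (θB * algebraMap ℂ B (m i)) • g m) (β : S (p + 1)) (r : Fin p → Fin (p + 1) → ℤ) :
    s • formLift B g ((1 : B) ⊗ₜ[ℂ] wedge rfl (d _ β) (dd fun j => mono (r j))) =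
      t • (∑ i, formLift B g ((1 : B) ⊗ₜ[ℂ] wedge rfl (d _ (u i)) (β • dd fun j => mono (r j))) +
        xB • formLift B g
          ((1 : B) ⊗ₜ[ℂ] wedge rfl (d _ (u₀ w)) (β • dd fun j => mono (r j)))) := by
  obtain ⟨N, hN, hv⟩ := exists_wedge_dd_mono r
  generalize hG : (monoBasis (p + 1)).constr ℂ g = G
  generalize hσ : (∑ j, r j) = σ at hN hv
  have hR := constr_relation (g := g) hs hg
  rw [hG] at hR
  have h1 : formLift B g ((1 : B) ⊗ₜ[ℂ] wedge rfl (d _ β) (dd fun j => mono (r j))) =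
      ∑ i, algebraMap ℂ B (N i) • G (logDer i β * mono σ) := by
    rw [formLift_tmul, hG, hv, map_sum]
    refine Finset.sum_congr rfl fun i _ => ?_
    rw [mul_smul_comm, map_smul, logCoord_d, algebraMap_smul]
  have h2 (γ : S (p + 1)) :
      formLift B g ((1 : B) ⊗ₜ[ℂ] wedge rfl (d _ γ) (β • dd fun j => mono (r j))) =
      ∑ i, algebraMap ℂ B (N i) • G (logDer i γ * (β * mono σ)) := by
    rw [formLift_tmul, hG, map_smul, map_smul, hv, smul_eq_mul, Finset.mul_sum, map_sum]
    refine Finset.sum_congr rfl fun i _ => ?_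
    rw [mul_smul_comm, mul_smul_comm, map_smul, logCoord_d, algebraMap_smul, mul_left_comm]
  have h3 (j) : ∑ i, algebraMap ℂ B (N i) • G (logDer i (u j) * (β * mono σ)) =
      algebraMap ℂ B (N j) • G (u j * (β * mono σ)) := by
    rw [Finset.sum_eq_single j]
    · rw [logDer_u, if_pos rfl]
    · intro i _ hi
      rw [logDer_u, if_neg hi.symm, zero_mul, map_zero, smul_zero]
    · simp
  have h4 (i) : G (logDer i (u₀ w) * (β * mono σ)) =
      -(algebraMap ℂ B (w i) • G (u₀ w * (β * mono σ))) := by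
    rw [logDer_u₀, smul_mul_assoc, map_smul, neg_smul, algebraMap_smul]
  have h5 (i) : G (logDer i (β * mono σ)) =
      G (logDer i β * mono σ) + algebraMap ℂ B (σ i) • G (β * mono σ) := by
    rw [Derivation.leibniz, logDer_mono, map_add, smul_eq_mul, mul_smul_comm, map_smul,
      algebraMap_smul, smul_eq_mul, mul_comm (mono σ), add_comm]
  have h6 : ∑ i, (algebraMap ℂ B (σ i) * algebraMap ℂ B (N i)) = 0 := by
    simp only [← map_mul, ← map_sum, hN, map_zero]
  simp only [h1, h2, h3, h4]
  have h7 (i) : algebraMap ℂ B (N i) • s • G (logDer i β * mono σ) =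
      t • (algebraMap ℂ B (N i) • G (u i * (β * mono σ)) +
        xB • algebraMap ℂ B (N i) • -(algebraMap ℂ B (w i) • G (u₀ w * (β * mono σ)))) -
      (algebraMap ℂ B (σ i) * algebraMap ℂ B (N i)) • s • G (β * mono σ) := by
    rw [eq_sub_of_add_eq (h5 i).symm, smul_sub, hR]
    module
  rw [Finset.smul_sum, Finset.smul_sum, ← Finset.sum_add_distrib, Finset.smul_sum]
  simp only [smul_comm s, h7]
  rw [Finset.sum_sub_distrib, ← Finset.sum_smul, h6, zero_smul, sub_zero]

/-- The map `c ↦ dc₁ ∧ ⋯ ∧ dc_p` as a multilinear map. -/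
def ddMultilinear (n p : ℕ) : MultilinearMap ℂ (fun _ : Fin p => S n) (Forms n p) :=
  ((exteriorPower.ιMulti (S n) p).toMultilinearMap.restrictScalars ℂ).compLinearMap
    fun _ => (d n).toLinearMap

theorem ddMultilinear_apply {p : ℕ} (v : Fin p → S n) : ddMultilinear n p v = dd v := rfl

theorem formLift_mem_ker {g : (Fin n → ℤ) → M} (hs : s = t * θB)
    (hg : ∀ m i, g (m + Pi.single i 1) - (algebraMap ℂ B (w i) * xB) • g (fun i => m i - w i) =
      (θB * algebraMap ℂ B (m i)) • g m) :
    twistedRel B xB w s t ≤ LinearMap.ker (formLift B g) := by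
  rw [twistedRel, Submodule.span_le]
  rintro _ ⟨p, h, β, v, rfl⟩
  subst h
  rw [SetLike.mem_coe, LinearMap.mem_ker, dFwedge_tmul]
  let ι : Forms (p + 1) (p + 1) →ₗ[ℂ] RelForms B (p + 1) (p + 1) := TensorProduct.mk ℂ B _ 1
  let mβ : Forms (p + 1) p →ₗ[ℂ] Forms (p + 1) p :=
    (LinearMap.lsmul (S (p + 1)) (Forms (p + 1) p) β).restrictScalars ℂ
  let wd (γ : S (p + 1)) : Forms (p + 1) p →ₗ[ℂ] Forms (p + 1) (p + 1) :=
    (wedge rfl (d _ γ)).restrictScalars ℂ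
  let T : Forms (p + 1) p →ₗ[ℂ] M := (formLift B g).restrictScalars ℂ ∘ₗ
    (s • (ι ∘ₗ wd β) - t • (∑ i, ι ∘ₗ wd (u i) ∘ₗ mβ + xB • (ι ∘ₗ wd (u₀ w) ∘ₗ mβ)))
  have hT (η) : T η = formLift B g (s • ((1 : B) ⊗ₜ[ℂ] wedge rfl (d _ β) η) -
      t • (∑ i, (1 : B) ⊗ₜ[ℂ] wedge rfl (d _ (u i)) (β • η) +
        xB • ((1 : B) ⊗ₜ[ℂ] wedge rfl (d _ (u₀ w)) (β • η)))) := by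
    simp only [T, LinearMap.comp_apply, LinearMap.sub_apply, LinearMap.smul_apply,
      LinearMap.add_apply, LinearMap.sum_apply]
    rfl
  -- For fixed β the relation is multilinear over ℂ in the functions cⱼ, so it is enough to take
  -- monomials.
  have h0 : T.compMultilinearMap (ddMultilinear (p + 1) p) = 0 := by
    refine Module.Basis.ext_multilinear (fun _ => monoBasis (p + 1)) fun r => ?_
    rw [LinearMap.compMultilinearMap_apply, ddMultilinear_apply, hT]
    simp only [monoBasis_apply]
    rw [map_sub, map_smul, map_smul, map_add, map_sum, map_smul, formLift_wedge_mono hs hg,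
      sub_self]
    rfl
  rw [← hT, ← ddMultilinear_apply, ← LinearMap.compMultilinearMap_apply, h0]
  rfl

theorem linearIndependent_vClass (hw : ∀ i, 0 < w i) (hx : IsUnit xB) (hs : s = t * θB)
    (δ : Derivation ℂ B B) (hδx : δ xB = xB) (hδθ : δ θB = 0) :
    LinearIndependent B (fun k : Fin (mu w) => vClass w B xB s t (a w k)) := by
  obtain ⟨f, h0, hf⟩ := exists_modelFun (w := w) (xB := xB) hδθ
  have hu : IsUnit (algebraMap ℂ B (kappa w) * xB) :=
    ((IsUnit.mk0 _ (kappa_ne_zero hw)).map _).mul hx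
  obtain ⟨y, hy⟩ := hu.exists_left_inv
  obtain ⟨g, hg⟩ := exists_modelMono hw hy (modelFun_add_W hw hδx h0 hf)
  -- The induced map sends [v^b] to f(b), hence the classes of the v^{a(k)} to the standard basis.
  let Φ : TwistedQuot w B xB s t →ₗ[B] Fin (mu w) → B :=
    (twistedRel B xB w s t).liftQ (formLift B g)
      (formLift_mem_ker hs (modelMono_relation hw hy hf hg))
  have hΦ (b) : Φ (vClass w B xB s t b) = f b := by
    have h1 : Φ (monoClass w B xB s t (toricExp w b)) = g (toricExp w b) :=
      (Submodule.liftQ_apply _ _ _).trans (formLift_mono g _)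
    have hp : (∏ i : Fin n, (w i : ℂ) ^ b i.succ) ≠ 0 :=
      Finset.prod_ne_zero_iff.2 fun i _ => pow_ne_zero _ (by exact_mod_cast (hw i).ne')
    rw [vClass, map_smul, h1, hg, smul_smul, wPow_toricExp hw]
    convert one_smul B (f b)
    rw [mul_assoc, ← mul_assoc (algebraMap ℂ B _), ← map_mul, inv_mul_cancel_left₀ hp, map_pow,
      ← mul_pow, ← mul_pow]
    rw [show xB * (algebraMap ℂ B (kappa w) * y) = 1 by linear_combination hy, one_pow]
  refine LinearIndependent.of_comp Φ ?_
  have : (Φ ∘ fun k : Fin (mu w) => vClass w B xB s t (a w k)) = Pi.basisFun B (Fin (mu w)) := by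
    ext1 k
    rw [Function.comp_apply, hΦ, modelFun_a h0 hf k.2.le, modelVec, dif_pos k.2, Pi.basisFun_apply]
  rw [this]
  exact (Pi.basisFun B (Fin (mu w))).linearIndependent

end Functional

/-! ### The connection in the basis -/

section Connection

variable {n : ℕ} (w : Fin n → ℕ)

theorem omega_eq_vClass (hw : ∀ i, 0 < w i) {k : ℕ} (hk : k < mu w) :
    omega w k = vClass w A₀ xA₀ thetaA₀ 1 (a w k) := by
  unfold omega vClass monoClass
  split_ifs with h
  · subst h
    have h1 : toricExp w (a w 0) = 0 := by ext i; simp [toricExp, a]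
    have h2 : xA₀ ^ a w 0 0 * algebraMap ℂ A₀ (∏ i : Fin n, (w i : ℂ) ^ a w 0 i.succ)⁻¹ = 1 := by
      simp only [a, Pi.zero_apply, pow_zero, Finset.prod_const_one, inv_one, map_one, mul_one]
    rw [h1, h2, mono_zero, one_smul, one_smul]
  · have h1 : mono (toricExp w (a w k)) = u₀ w * ∏ i : Fin n, u i ^ a w k i.succ := by
      have h2 (i : Fin n) : u i ^ a w k i.succ = mono (Pi.single i (a w k i.succ : ℤ)) := by
        rw [u, ← Finset.card_range (a w k i.succ), ← Finset.prod_const, prod_mono,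
          Finset.sum_const, Finset.card_range, ← Pi.single_smul]
        simp
      rw [Finset.prod_congr rfl fun i _ => h2 i, prod_mono, u₀, mono_mul]
      congr 1
      ext i
      simp [toricExp, a_apply_zero hw hk.le h, Finset.sum_apply, Pi.single_apply]
      ring
    rw [h1, a_apply_zero hw hk.le h, pow_one, ← map_smul, TensorProduct.smul_tmul', smul_eq_mul,
      mul_one, mul_comm xA₀, ← Algebra.smul_def]

theorem toG_mkQ (z : RelForms A₀ n n) :
    toG w ((twistedRel A₀ xA₀ w thetaA₀ 1).mkQ z) =
      (twistedRel A x w 1 tau).mkQ (inclForms n n z) :=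
  Submodule.liftQ_apply _ _ _

theorem toG_monoClass (m : Fin n → ℤ) :
    toG w (monoClass w A₀ xA₀ thetaA₀ 1 m) = monoClass w A x 1 tau m := by
  rw [monoClass, monoClass, toG_mkQ, inclForms_tmul, map_one]

theorem toG_vClass (b : Fin (n + 1) → ℕ) :
    toG w (vClass w A₀ xA₀ thetaA₀ 1 b) = vClass w A x 1 tau b := by
  rw [vClass, map_smul, toG_monoClass, vClass, ← algebraMap_smul A, map_mul, map_pow,
    algebraMap_xA₀, ← IsScalarTower.algebraMap_apply]

theorem isUnit_xA₀ : IsUnit xA₀ := by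
  refine IsUnit.of_mul_eq_one (AddMonoidAlgebra.single (-1, 0) 1) ?_
  simp [xA₀, AddMonoidAlgebra.single_mul_single, AddMonoidAlgebra.one_def, ← Prod.zero_eq_mk]

theorem x_mul_xInv : x * xInv = 1 := by
  simp [x, xInv, AddMonoidAlgebra.single_mul_single, AddMonoidAlgebra.one_def,
    ← Prod.zero_eq_mk]

theorem isUnit_x : IsUnit x := IsUnit.of_mul_eq_one _ x_mul_xInv

theorem isUnit_tau : IsUnit tau :=
  IsUnit.of_mul_eq_one theta (by rw [mul_comm, theta_mul_tau])

theorem one_eq_tau_mul_theta : 1 = tau * theta := by rw [mul_comm, theta_mul_tau]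

variable {w}

theorem span_vClass_A₀ (hw : ∀ i, 0 < w i) : Submodule.span A₀
    (Set.range fun k : Fin (mu w) => vClass w A₀ xA₀ thetaA₀ 1 (a w k)) = ⊤ :=
  span_vClass_eq_top A₀ xA₀ hw isUnit_xA₀ isUnit_one (one_mul _).symm

theorem span_vClass_A (hw : ∀ i, 0 < w i) : Submodule.span A
    (Set.range fun k : Fin (mu w) => vClass w A x 1 tau (a w k)) = ⊤ :=
  span_vClass_eq_top A x hw isUnit_x isUnit_tau one_eq_tau_mul_theta

theorem linearIndependent_vClass_A₀ (hw : ∀ i, 0 < w i) : LinearIndependent A₀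
    fun k : Fin (mu w) => vClass w A₀ xA₀ thetaA₀ 1 (a w k) :=
  linearIndependent_vClass hw isUnit_xA₀ (one_mul _).symm
    (euler ((Int.castAddHom ℂ).comp (AddMonoidHom.fst ℤ ℕ))) (by simp [xA₀, euler_single])
    (by simp [thetaA₀, euler_single])

theorem linearIndependent_vClass_A (hw : ∀ i, 0 < w i) : LinearIndependent A
    fun k : Fin (mu w) => vClass w A x 1 tau (a w k) :=
  linearIndependent_vClass hw isUnit_x one_eq_tau_mul_theta
    (euler ((Int.castAddHom ℂ).comp (AddMonoidHom.fst ℤ ℤ))) (by simp [x, euler_single])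
    (by simp [theta, euler_single])

variable (w)

theorem nablaX_mkQ (z : RelForms A n n) : nablaX w ((twistedRel A x w 1 tau).mkQ z) =
    (twistedRel A x w 1 tau).mkQ (preNablaX w z) := descend_mk _ _ _ _

theorem nablaTau_mkQ (z : RelForms A n n) : nablaTau w ((twistedRel A x w 1 tau).mkQ z) =
    (twistedRel A x w 1 tau).mkQ (preNablaTau w z) := descend_mk _ _ _ _

theorem nablaX_smul (β : A) (g : G w) : nablaX w (β • g) = ddx β • g + β • nablaX w g := by
  obtain ⟨z, rfl⟩ := (twistedRel A x w 1 tau).mkQ_surjective g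
  have : preNablaX w (β • z) = ddx β • z + β • preNablaX w z := by
    simp only [preNablaX, LinearMap.sub_apply, coeffDer_smul, LinearMap.restrictScalars_apply,
      map_smul, smul_sub]
    abel
  rw [← map_smul, nablaX_mkQ, this, map_add, map_smul, map_smul, nablaX_mkQ]

theorem nablaTau_smul (β : A) (g : G w) :
    nablaTau w (β • g) = ddtau β • g + β • nablaTau w g := by
  obtain ⟨z, rfl⟩ := (twistedRel A x w 1 tau).mkQ_surjective g
  have : preNablaTau w (β • z) = ddtau β • z + β • preNablaTau w z := by
    simp only [preNablaTau, LinearMap.sub_apply, coeffDer_smul, LinearMap.restrictScalars_apply,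
      map_smul, smul_sub]
    abel
  rw [← map_smul, nablaTau_mkQ, this, map_add, map_smul, map_smul, nablaTau_mkQ]

theorem mulBy_tmul (g : S n) (η : Forms n n) :
    mulBy A n g ((1 : A) ⊗ₜ[ℂ] η) = (1 : A) ⊗ₜ[ℂ] (g • η) := by
  simp [mulBy]

theorem nablaX_monoClass (m : Fin n → ℤ) : nablaX w (monoClass w A x 1 tau m) =
    -(tau • monoClass w A x 1 tau (fun i => m i - w i)) := by
  rw [monoClass, nablaX_mkQ, preNablaX, LinearMap.sub_apply, coeffDer_tmul_one,
    LinearMap.restrictScalars_apply, LinearMap.smul_apply, mulBy_tmul, smul_smul, u₀_mul_mono,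
    map_sub, map_zero, map_smul, zero_sub]
  rfl

theorem nablaTau_monoClass (m : Fin n → ℤ) : nablaTau w (monoClass w A x 1 tau m) =
    -(∑ i, monoClass w A x 1 tau (m + Pi.single i 1) +
      x • monoClass w A x 1 tau (fun i => m i - w i)) := by
  rw [monoClass, nablaTau_mkQ, preNablaTau, LinearMap.sub_apply, coeffDer_tmul_one,
    LinearMap.restrictScalars_apply, mulF, LinearMap.add_apply, LinearMap.sum_apply,
    LinearMap.smul_apply, mulBy_tmul, smul_smul, u₀_mul_mono, map_sub, map_zero, map_add, map_sum,
    map_smul, zero_sub]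
  simp only [mulBy_tmul, smul_smul, u_mul_mono]
  rfl

variable {w}

/-- For i = 0 this is a direct computation: ∂/∂x acts on x^{b₀}, and x u₀ = v₀. The relations make
the right side independent of i. -/
theorem nablaX_vClass (hw : ∀ i, 0 < w i) (b : Fin (n + 1) → ℕ) (i : Fin (n + 1)) :
    nablaX w (vClass w A x 1 tau b) =
      xInv • (algebraMap ℂ A (b i / W w i) • vClass w A x 1 tau b -
        tau • vClass w A x 1 tau (b + Pi.single i 1)) := by
  have h1 := vClass_add_sub_zero A x hw isUnit_tau one_eq_tau_mul_theta b i
  rw [sub_eq_iff_eq_add] at h1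
  have h2 : ∀ k : ℕ, ddx (x ^ k) = algebraMap ℂ A k * xInv * x ^ k := by
    intro k
    rw [Derivation.leibniz_pow, ddx_x, smul_eq_mul, mul_one, nsmul_eq_mul, map_natCast]
    obtain _ | k := k
    · simp
    · rw [Nat.add_sub_cancel, pow_succ]
      linear_combination (-(↑(k + 1) : A) * x ^ k) * x_mul_xInv
  have h3 : ddx (x ^ b 0 * algebraMap ℂ A (∏ i : Fin n, (w i : ℂ) ^ b i.succ)⁻¹) =
      algebraMap ℂ A (b 0) * xInv *
        (x ^ b 0 * algebraMap ℂ A (∏ i : Fin n, (w i : ℂ) ^ b i.succ)⁻¹) := by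
    rw [Derivation.leibniz, Derivation.map_algebraMap, smul_zero, zero_add, h2, smul_eq_mul]
    ring
  rw [h1, vClass_add_zero, vClass, nablaX_smul, nablaX_monoClass, h3]
  generalize x ^ b 0 * algebraMap ℂ A (∏ i : Fin n, (w i : ℂ) ^ b i.succ)⁻¹ = z
  rw [map_sub]
  generalize monoClass w A x 1 tau (toricExp w b) = y
  generalize monoClass w A x 1 tau (fun i => toricExp w b i - w i) = y'
  generalize algebraMap ℂ A (b i / W w i) = α
  generalize algebraMap ℂ A (b 0) = β
  linear_combination (norm := module)
    (xInv * z * (α - β) * theta_mul_tau) • y + (z * tau * x_mul_xInv) • y'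

/-- The scalar in front of u^m is free of τ, so ∇_τ is multiplication by −F = −Σ w_j v_j. Moving
every v_j to v_i costs θ (b_j − w_j b_i/w_i), and the sum over j gives |b| − μ b_i/w_i. -/
theorem nablaTau_vClass (hw : ∀ i, 0 < w i) (b : Fin (n + 1) → ℕ) (i : Fin (n + 1)) :
    nablaTau w (vClass w A x 1 tau b) =
      -(algebraMap ℂ A (mu w) • vClass w A x 1 tau (b + Pi.single i 1) +
        (theta * algebraMap ℂ A ((∑ j, b j : ℕ) - mu w * (b i / W w i))) •
          vClass w A x 1 tau b) := by
  have h1 : ddtau (x ^ b 0 * algebraMap ℂ A (∏ i : Fin n, (w i : ℂ) ^ b i.succ)⁻¹) = 0 := by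
    rw [Derivation.leibniz, Derivation.map_algebraMap, Derivation.leibniz_pow, ddtau_x]
    simp
  have h2 : nablaTau w (vClass w A x 1 tau b) =
      -∑ j, algebraMap ℂ A (W w j) • vClass w A x 1 tau (b + Pi.single j 1) := by
    rw [Fin.sum_univ_succ, vClass_add_zero]
    simp only [W_succ, W_zero, vClass_add_succ A x 1 tau hw]
    rw [vClass, nablaTau_smul, h1, nablaTau_monoClass, ← Finset.smul_sum]
    simp only [Nat.cast_one, map_one]
    module
  have h3 (j) : algebraMap ℂ A (W w j) • vClass w A x 1 tau (b + Pi.single j 1) =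
      algebraMap ℂ A (W w j) • vClass w A x 1 tau (b + Pi.single i 1) +
        (theta * algebraMap ℂ A (b j - W w j * (b i / W w i))) • vClass w A x 1 tau b := by
    have hW : (W w j : ℂ) ≠ 0 := by exact_mod_cast (W_pos hw j).ne'
    have h4 : algebraMap ℂ A (b j - W w j * (b i / W w i)) =
        algebraMap ℂ A (W w j) * algebraMap ℂ A (b j / W w j - b i / W w i) := by
      rw [← map_mul]
      congr 1
      field_simp
    rw [eq_add_of_sub_eq (vClass_add_sub A x hw isUnit_tau one_eq_tau_mul_theta b j i), h4]
    module
  rw [h2, Finset.sum_congr rfl fun j _ => h3 j, Finset.sum_add_distrib, ← Finset.sum_smul,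
    ← Finset.sum_smul, ← Finset.mul_sum, ← map_sum, ← map_sum, Finset.sum_sub_distrib,
    ← Finset.sum_mul, mu]
  push_cast
  rfl

/-! ### The matrices of ∇ -/

variable (w) in
/-- The matrix of the shift `v^{a(k)} ↦ v^{a(k+1)}`, over `ℂ[x, θ, θ⁻¹]`. -/
def shiftMatrix : Matrix (Fin (mu w)) (Fin (mu w)) R := fun j k =>
  if (j : ℕ) = k + 1 then 1
  else if (j : ℕ) = 0 ∧ (k : ℕ) + 1 = mu w then algebraMap ℂ R (kappa w) * xR
  else 0

/-- The last column closes the cycle: a(μ) = W, and [v^W] = κ x [v⁰]. -/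
theorem sum_shiftMatrix_smul (hw : ∀ i, 0 < w i) (k : Fin (mu w)) :
    ∑ j, algebraMap R A (shiftMatrix w j k) • vClass w A x 1 tau (a w j) =
      vClass w A x 1 tau (a w (k + 1)) := by
  rcases Nat.lt_or_ge (k + 1) (mu w) with h | h
  · rw [Finset.sum_eq_single ⟨k + 1, h⟩]
    · rw [shiftMatrix, if_pos rfl, map_one, one_smul]
    · intro j _ hj
      have h1 : (j : ℕ) ≠ k + 1 := fun e => hj (Fin.ext e)
      rw [shiftMatrix, if_neg h1, if_neg (by omega), map_zero, zero_smul]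
    · simp
  · have hk : (k : ℕ) + 1 = mu w := by omega
    have h2 := vClass_add_W A x 1 tau (w := w) 0
    rw [zero_add, ← a_mu hw] at h2
    rw [hk, h2, Finset.sum_eq_single ⟨0, mu_pos⟩]
    · have h0 : a w 0 = 0 := rfl
      rw [shiftMatrix, if_neg (by simp), if_pos ⟨rfl, hk⟩, h0, map_mul, algebraMap_xR,
        ← IsScalarTower.algebraMap_apply]
    · intro j _ hj
      have h1 : (j : ℕ) ≠ 0 := fun e => hj (Fin.ext e)
      rw [shiftMatrix, if_neg (by omega), if_neg (by tauto), map_zero, zero_smul]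
    · simp

theorem A0phi_eq (j k : Fin (mu w)) :
    A0phi w j k = algebraMap ℂ A (mu w) * algebraMap R A (shiftMatrix w j k) := by
  unfold A0phi shiftMatrix
  split_ifs
  · rw [map_one, mul_one]
  · rw [map_mul, algebraMap_xR, ← IsScalarTower.algebraMap_apply, kappa, div_eq_mul_inv, map_mul,
      mul_assoc]
  · rw [map_zero, mul_zero]

theorem sum_A0phi_smul (hw : ∀ i, 0 < w i) (k : Fin (mu w)) :
    ∑ j, A0phi w j k • vClass w A x 1 tau (a w j) =
      algebraMap ℂ A (mu w) • vClass w A x 1 tau (a w (k + 1)) := by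
  simp only [A0phi_eq, mul_smul]
  rw [← Finset.smul_sum, sum_shiftMatrix_smul hw]

theorem sum_diagonal_smul {ι R M : Type*} [Fintype ι] [DecidableEq ι] [Semiring R]
    [AddCommMonoid M] [Module R M] (D : ι → R) (v : ι → M) (k : ι) :
    ∑ j, Matrix.diagonal D j k • v j = D k • v k := by
  rw [Finset.sum_eq_single k]
  · rw [Matrix.diagonal_apply_eq]
  · intro j _ hj
    rw [Matrix.diagonal_apply_ne _ hj, zero_smul]
  · simp

theorem alpha_eq (hw : ∀ i, 0 < w i) {k : ℕ} (hk : k < mu w) :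
    (alpha w k : ℂ) = k - mu w * slope w k := by
  rw [alpha, c_eq_slope hw hk]
  push_cast
  rfl

theorem slope_cast (k : ℕ) :
    (slope w k : ℂ) = a w k (argmin w (a w k)) / W w (argmin w (a w k)) := by
  simp [slope]

theorem nablaX_vClass_a (hw : ∀ i, 0 < w i) (k : ℕ) :
    nablaX w (vClass w A x 1 tau (a w k)) =
      xInv • (algebraMap ℂ A (slope w k) • vClass w A x 1 tau (a w k) -
        tau • vClass w A x 1 tau (a w (k + 1))) := by
  rw [nablaX_vClass hw _ (argmin w (a w k)), ← slope_cast, a_succ]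

theorem nablaTheta_vClass_a (hw : ∀ i, 0 < w i) (k : ℕ) :
    nablaTheta w (vClass w A x 1 tau (a w k)) =
      (tau * tau * algebraMap ℂ A (mu w)) • vClass w A x 1 tau (a w (k + 1)) +
        (tau * algebraMap ℂ A (k - mu w * slope w k)) • vClass w A x 1 tau (a w k) := by
  rw [nablaTheta, nablaTau_vClass hw _ (argmin w (a w k)), ← slope_cast, a_succ, sum_a]
  generalize vClass w A x 1 tau (a w k) = y
  generalize vClass w A x 1 tau (_ + _) = y'
  generalize algebraMap ℂ A (k - mu w * slope w k) = α
  linear_combination (norm := module) (tau * α * theta_mul_tau) • y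

theorem nablaTheta_eq_sum (hw : ∀ i, 0 < w i) (k : Fin (mu w)) :
    nablaTheta w (vClass w A x 1 tau (a w k)) =
      ∑ j, thetaMatrix w j k • vClass w A x 1 tau (a w j) := by
  simp only [thetaMatrix, Matrix.smul_apply, Matrix.add_apply, smul_eq_mul, mul_smul, add_smul,
    smul_add, Finset.sum_add_distrib, ← Finset.smul_sum, sum_A0phi_smul hw, Ainf,
    sum_diagonal_smul]
  rw [nablaTheta_vClass_a hw, alpha_eq hw k.2]
  module

theorem nablaX_eq_sum (hw : ∀ i, 0 < w i) (k : Fin (mu w)) :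
    nablaX w (vClass w A x 1 tau (a w k)) =
      ∑ j, xMatrix w j k • vClass w A x 1 tau (a w j) := by
  simp only [xMatrix, Matrix.smul_apply, Matrix.add_apply, Matrix.sub_apply, Matrix.neg_apply,
    smul_eq_mul, mul_smul, add_smul, sub_smul, neg_smul, ← Finset.smul_sum,
    Finset.sum_add_distrib, Finset.sum_sub_distrib, Finset.sum_neg_distrib, sum_A0phi_smul hw,
    Ainf, H, sum_diagonal_smul]
  rw [nablaX_vClass_a hw, alpha_eq hw k.2]
  -- Since k − α_k = μ · slope, dividing by μ leaves the slope.
  have h1 : algebraMap ℂ A (1 / mu w) * algebraMap ℂ A (mu w) = 1 := by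
    have : (mu w : ℂ) ≠ 0 := by exact_mod_cast mu_pos.ne'
    rw [← map_mul, one_div_mul_cancel this, map_one]
  rw [map_sub, map_mul]
  generalize algebraMap ℂ A (1 / mu w) = p at h1
  generalize algebraMap ℂ A (mu w) = q at h1
  generalize vClass w A x 1 tau (a w k) = y
  generalize vClass w A x 1 tau (a w (k + 1)) = y'
  generalize algebraMap ℂ A (slope w k) = α
  linear_combination (norm := module) (-(xInv * α) * h1) • y + (xInv * tau * h1) • y'

end Connection

/-! ### The canonical extension -/

section Deligne

/-- `θ⁻¹`, as an element of `ℂ[x, θ, θ⁻¹]`. -/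
def tauR : R := AddMonoidAlgebra.single (0, -1) 1

theorem algebraMap_R_single (m : ℕ × ℤ) (z : ℂ) :
    algebraMap R A (AddMonoidAlgebra.single m z) =
      AddMonoidAlgebra.single ((m.1 : ℤ), m.2) z := by
  change inclR _ = _
  simp [inclR, Prod.map]

theorem algebraMap_tauR : algebraMap R A tauR = tau := algebraMap_R_single _ _

theorem algebraMap_R_injective : Function.Injective (algebraMap R A) := by
  have : Function.Injective inclR := by
    refine AddMonoidAlgebra.mapDomain_injective ?_
    rintro ⟨p, q⟩ ⟨p', q'⟩ h
    simpa [Prod.ext_iff] using h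
  exact this

/-- The derivation `x ∂/∂x` of `ℂ[x, θ, θ⁻¹]`. -/
def eulerX : Derivation ℂ R R := euler ((Nat.castAddMonoidHom ℂ).comp (AddMonoidHom.fst ℕ ℤ))

/-- The derivation `∂/∂θ` of `ℂ[x, θ, θ⁻¹]`. -/
def ddtheta : Derivation ℂ R R :=
  tauR • euler ((Int.castAddHom ℂ).comp (AddMonoidHom.snd ℕ ℤ))

theorem algebraMap_eulerX (r : R) : algebraMap R A (eulerX r) = x * ddx (algebraMap R A r) := by
  induction r using AddMonoidAlgebra.induction_linear with
  | zero => simp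
  | add r r' h h' => simp only [map_add, h, h', mul_add]
  | single m z =>
    rw [algebraMap_R_single, eulerX, euler_single, algebraMap_R_single, ddx, Derivation.smul_apply,
      smul_eq_mul, ← mul_assoc, x_mul_xInv, one_mul, euler_single]
    simp

theorem algebraMap_ddtheta (r : R) :
    algebraMap R A (ddtheta r) = -(tau ^ 2) * ddtau (algebraMap R A r) := by
  have h : -(tau ^ 2) * theta = -tau := by linear_combination (-tau) * theta_mul_tau
  induction r using AddMonoidAlgebra.induction_linear with
  | zero => simp
  | add r r' h h' => simp only [map_add, h, h', mul_add]
  | single m z =>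
    rw [algebraMap_R_single, ddtheta, Derivation.smul_apply, smul_eq_mul, euler_single, map_mul,
      algebraMap_tauR, algebraMap_R_single, ddtau, Derivation.smul_apply,
      smul_eq_mul, ← mul_assoc, h, euler_single]
    simp

/-- The bound holds for all larger k too, so that one power of x clears finitely many denominators
at once. -/
theorem exists_pow_mul_eq_algebraMap (β : A) :
    ∃ m : ℕ, ∀ k ≥ m, ∃ r : R, x ^ k * β = algebraMap R A r := by
  induction β using AddMonoidAlgebra.induction_linear with
  | zero => exact ⟨0, fun k _ => ⟨0, by simp⟩⟩
  | add β β' h h' =>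
    obtain ⟨m, hm⟩ := h
    obtain ⟨m', hm'⟩ := h'
    refine ⟨max m m', fun k hk => ?_⟩
    obtain ⟨r, hr⟩ := hm k (le_trans (le_max_left _ _) hk)
    obtain ⟨r', hr'⟩ := hm' k (le_trans (le_max_right _ _) hk)
    exact ⟨r + r', by rw [mul_add, hr, hr', map_add]⟩
  | single p z =>
    refine ⟨p.1.natAbs, fun k hk => ⟨AddMonoidAlgebra.single ((k + p.1).toNat, p.2) z, ?_⟩⟩
    have h1 : 0 ≤ k + p.1 := by omega
    rw [algebraMap_R_single, x, AddMonoidAlgebra.single_pow, AddMonoidAlgebra.single_mul_single]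
    congr 1
    · ext <;> simp [h1]
    · simp

/-- The evaluation of `ℂ[x, θ, θ⁻¹]` at the point `(0, t)`. -/
def evalPoint (t : ℂ) (ht : t ≠ 0) : R →ₐ[ℂ] ℂ :=
  AddMonoidAlgebra.lift ℂ ℂ (ℕ × ℤ)
    { toFun := fun m => 0 ^ m.toAdd.1 * t ^ m.toAdd.2
      map_one' := by simp
      map_mul' := fun m m' => by
        simp only [toAdd_mul, Prod.fst_add, Prod.snd_add, pow_add, zpow_add₀ ht]
        ring }

variable {t : ℂ} (ht : t ≠ 0)

theorem evalPoint_single (m : ℕ × ℤ) (z : ℂ) :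
    evalPoint t ht (AddMonoidAlgebra.single m z) = z * (0 ^ m.1 * t ^ m.2) := by
  simp [evalPoint]

theorem evalPoint_xR : evalPoint t ht xR = 0 := by simp [xR, evalPoint_single]

theorem evalPoint_thetaR : evalPoint t ht thetaR = t := by simp [thetaR, evalPoint_single]

/-- Every value of x ∂/∂x is divisible by x; hence the residue is linear on the fibre and is given
by the evaluated matrix. -/
theorem evalPoint_eulerX (r : R) : evalPoint t ht (eulerX r) = 0 := by
  induction r using AddMonoidAlgebra.induction_linear with
  | zero => simp
  | add r r' h h' => simp only [map_add, h, h', add_zero]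
  | single m z =>
    rw [eulerX, euler_single, evalPoint_single]
    obtain ⟨p, q⟩ := m
    obtain _ | p := p <;> simp

theorem thetaR_mul_tauR : thetaR * tauR = 1 := by
  simp [thetaR, tauR, AddMonoidAlgebra.single_mul_single, AddMonoidAlgebra.one_def,
    ← Prod.zero_eq_mk]

/-- The quotient map by (x, θ − t) factors through the evaluation, as one sees on x, θ and θ⁻¹. -/
theorem mem_pointIdeal_iff (r : R) : r ∈ pointIdeal t ↔ evalPoint t ht r = 0 := by
  constructor
  · intro h
    have : pointIdeal t ≤ RingHom.ker (evalPoint t ht) := by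
      rw [pointIdeal, Ideal.span_le]
      rintro _ (rfl | rfl)
      · exact evalPoint_xR ht
      · change evalPoint t ht _ = 0
        rw [map_sub, evalPoint_thetaR, AlgHom.commutes]
        exact sub_self t
    exact this h
  · intro h
    let π := Ideal.Quotient.mkₐ ℂ (pointIdeal t)
    have hx : π xR = 0 := Ideal.Quotient.eq_zero_iff_mem.2 (Ideal.subset_span (Or.inl rfl))
    have hθ : π thetaR = algebraMap ℂ _ t := by
      rw [← AlgHom.commutes π, ← sub_eq_zero, ← map_sub]
      exact Ideal.Quotient.eq_zero_iff_mem.2 (Ideal.subset_span (Or.inr rfl))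
    have hτ : π tauR = algebraMap ℂ _ t⁻¹ := by
      have h1 : algebraMap ℂ (R ⧸ pointIdeal t) t⁻¹ * algebraMap ℂ _ t = 1 := by
        rw [← map_mul, inv_mul_cancel₀ ht, map_one]
      have h2 : π thetaR * π tauR = 1 := by rw [← map_mul, thetaR_mul_tauR, map_one]
      rw [hθ] at h2
      linear_combination (-π tauR) * h1 + algebraMap ℂ _ t⁻¹ * h2
    have key : π = (Algebra.ofId ℂ _).comp (evalPoint t ht) := by
      refine AddMonoidAlgebra.algHom_ext (fun m => ?_) (Subsingleton.elim _ _)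
      have hm : (AddMonoidAlgebra.single m 1 : R) =
          xR ^ m.1 * (thetaR ^ m.2.toNat * tauR ^ (-m.2).toNat) := by
        simp only [xR, thetaR, tauR, AddMonoidAlgebra.single_pow,
          AddMonoidAlgebra.single_mul_single]
        congr 1
        · ext
          · simp
          · simp
            omega
        · simp
      have hτ' : evalPoint t ht tauR = t⁻¹ := by simp [tauR, evalPoint_single]
      rw [hm]
      simp only [map_mul, map_pow, hx, hθ, hτ, AlgHom.comp_apply, evalPoint_xR, evalPoint_thetaR,
        hτ', map_zero]
      rfl
    have h1 : π r = 0 := by rw [key, AlgHom.comp_apply, h, map_zero]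
    exact Ideal.Quotient.eq_zero_iff_mem.1 h1

end Deligne

/-! ### The lattice and its residue -/

section Lattice

variable {n : ℕ} {w : Fin n → ℕ}

theorem linearIndependent_vClass_R (hw : ∀ i, 0 < w i) : LinearIndependent R
    fun k : Fin (mu w) => vClass w A x 1 tau (a w k) := by
  refine (linearIndependent_vClass_A hw).restrict_scalars fun r r' h => ?_
  simpa [Algebra.smul_def, algebraMap_R_injective.eq_iff] using h

variable (w) in
/-- The `ℂ[x, θ, θ⁻¹]`-lattice spanned by the basis of `G`. -/
def lattice : Submodule R (G w) :=
  Submodule.span R (Set.range fun k : Fin (mu w) => vClass w A x 1 tau (a w k))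

theorem vClass_mem_lattice (k : Fin (mu w)) : vClass w A x 1 tau (a w k) ∈ lattice w :=
  Submodule.subset_span ⟨k, rfl⟩

theorem vClass_succ_mem_lattice (hw : ∀ i, 0 < w i) (k : Fin (mu w)) :
    vClass w A x 1 tau (a w (k + 1)) ∈ lattice w := by
  rw [← sum_shiftMatrix_smul hw]
  refine sum_mem fun j _ => ?_
  rw [algebraMap_smul]
  exact Submodule.smul_mem _ _ (vClass_mem_lattice j)

theorem mem_lattice_iff (g : G w) : g ∈ lattice w ↔
    ∃ r : Fin (mu w) → R, ∑ k, r k • vClass w A x 1 tau (a w k) = g :=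
  Submodule.mem_span_range_iff_exists_fun R

/-- Coordinates in the basis are unique, so the fibre at a point is computed coordinatewise. -/
theorem sum_mem_ideal_smul_lattice_iff (hw : ∀ i, 0 < w i) (I : Ideal R)
    (r : Fin (mu w) → R) :
    ∑ k, r k • vClass w A x 1 tau (a w k) ∈ I • lattice w ↔ ∀ k, r k ∈ I := by
  constructor
  · intro h
    rw [lattice, Submodule.mem_ideal_smul_span_iff_exists_sum] at h
    obtain ⟨q, hq, h⟩ := h
    rw [q.sum_fintype _ (by simp), ← sub_eq_zero,
      ← Finset.sum_sub_distrib] at h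
    simp only [← sub_smul] at h
    intro k
    rw [← sub_eq_zero.1 (Fintype.linearIndependent_iff.1 (linearIndependent_vClass_R hw) _ h k)]
    exact hq k
  · intro h
    exact sum_mem fun k _ => Submodule.smul_mem_smul (h k) (vClass_mem_lattice k)

theorem lattice_projective (hw : ∀ i, 0 < w i) : Module.Projective R (lattice w) :=
  Module.Projective.of_basis (Module.Basis.span (linearIndependent_vClass_R hw))

theorem exists_pow_smul_mem_lattice (hw : ∀ i, 0 < w i) (g : G w) :
    ∃ m : ℕ, x ^ m • g ∈ lattice w := by
  have hg : g ∈ Submodule.span A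
      (Set.range fun k : Fin (mu w) => vClass w A x 1 tau (a w k)) := by
    rw [span_vClass_A hw]
    trivial
  obtain ⟨β, rfl⟩ := (Submodule.mem_span_range_iff_exists_fun A).1 hg
  choose m hm using fun k => exists_pow_mul_eq_algebraMap (β k)
  refine ⟨∑ k, m k, ?_⟩
  rw [Finset.smul_sum]
  refine sum_mem fun k _ => ?_
  obtain ⟨r, hr⟩ := hm k (∑ k, m k)
    (Finset.single_le_sum (f := m) (fun _ _ => Nat.zero_le _) (Finset.mem_univ k))
  rw [smul_smul, hr, algebraMap_smul]
  exact Submodule.smul_mem _ _ (vClass_mem_lattice k)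

theorem x_smul_nablaX_smul (r : R) (g : G w) :
    x • nablaX w (r • g) = eulerX r • g + r • x • nablaX w g := by
  rw [← algebraMap_smul A r, ← algebraMap_smul A r, ← algebraMap_smul A (eulerX r), nablaX_smul,
    algebraMap_eulerX]
  module

theorem nablaTheta_smul (r : R) (g : G w) :
    nablaTheta w (r • g) = ddtheta r • g + r • nablaTheta w g := by
  rw [← algebraMap_smul A r, ← algebraMap_smul A r, ← algebraMap_smul A (ddtheta r), nablaTheta,
    nablaTheta, nablaTau_smul, algebraMap_ddtheta]
  module

theorem x_smul_nablaX_vClass_a (hw : ∀ i, 0 < w i) (k : ℕ) :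
    x • nablaX w (vClass w A x 1 tau (a w k)) =
      algebraMap ℂ R (slope w k) • vClass w A x 1 tau (a w k) -
        tauR • vClass w A x 1 tau (a w (k + 1)) := by
  rw [nablaX_vClass_a hw, smul_smul, x_mul_xInv, one_smul, ← algebraMap_smul A (algebraMap ℂ R _),
    ← algebraMap_smul A tauR, algebraMap_tauR, ← IsScalarTower.algebraMap_apply]

theorem x_smul_nablaX_mem_lattice (hw : ∀ i, 0 < w i) {g : G w} (hg : g ∈ lattice w) :
    x • nablaX w g ∈ lattice w := by
  induction hg using Submodule.span_induction with
  | zero => simp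
  | add g g' _ _ h h' => rw [map_add, smul_add]; exact add_mem h h'
  | smul r g hg h =>
    rw [x_smul_nablaX_smul]
    exact add_mem (Submodule.smul_mem _ _ hg) (Submodule.smul_mem _ _ h)
  | mem g hg =>
    obtain ⟨k, rfl⟩ := hg
    rw [x_smul_nablaX_vClass_a hw]
    exact sub_mem (Submodule.smul_mem _ _ (vClass_mem_lattice k))
      (Submodule.smul_mem _ _ (vClass_succ_mem_lattice hw k))

theorem nablaTheta_mem_lattice (hw : ∀ i, 0 < w i) {g : G w} (hg : g ∈ lattice w) :
    nablaTheta w g ∈ lattice w := by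
  induction hg using Submodule.span_induction with
  | zero => simp [nablaTheta]
  | add g g' _ _ h h' =>
    have : nablaTheta w (g + g') = nablaTheta w g + nablaTheta w g' := by
      simp only [nablaTheta, map_add, smul_add]
    rw [this]
    exact add_mem h h'
  | smul r g hg h =>
    rw [nablaTheta_smul]
    exact add_mem (Submodule.smul_mem _ _ hg) (Submodule.smul_mem _ _ h)
  | mem g hg =>
    obtain ⟨k, rfl⟩ := hg
    have h1 : tau * tau * algebraMap ℂ A (mu w) =
        algebraMap R A (tauR * tauR * algebraMap ℂ R (mu w)) := by
      rw [map_mul, map_mul, algebraMap_tauR, ← IsScalarTower.algebraMap_apply]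
    have h2 : tau * algebraMap ℂ A (k - mu w * slope w k) =
        algebraMap R A (tauR * algebraMap ℂ R (k - mu w * slope w k)) := by
      rw [map_mul, algebraMap_tauR, ← IsScalarTower.algebraMap_apply]
    rw [nablaTheta_vClass_a hw, h1, h2, algebraMap_smul, algebraMap_smul]
    exact add_mem (Submodule.smul_mem _ _ (vClass_succ_mem_lattice hw k))
      (Submodule.smul_mem _ _ (vClass_mem_lattice k))

variable (w) in
/-- The matrix of `x ∇_{∂_x}` in the basis of the lattice. -/
def logMatrix : Matrix (Fin (mu w)) (Fin (mu w)) R :=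
  Matrix.diagonal (fun k : Fin (mu w) => algebraMap ℂ R (slope w k)) - tauR • shiftMatrix w

theorem x_smul_nablaX_sum (hw : ∀ i, 0 < w i) (r : Fin (mu w) → R) :
    x • nablaX w (∑ k, r k • vClass w A x 1 tau (a w k)) =
      ∑ j, (eulerX (r j) + ∑ k, r k * logMatrix w j k) • vClass w A x 1 tau (a w j) := by
  have h (k : Fin (mu w)) : x • nablaX w (vClass w A x 1 tau (a w k)) =
      ∑ j, logMatrix w j k • vClass w A x 1 tau (a w j) := by
    have h1 := sum_shiftMatrix_smul hw k
    simp only [algebraMap_smul] at h1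
    simp only [logMatrix, Matrix.sub_apply, Matrix.smul_apply, sub_smul, smul_eq_mul, mul_smul,
      Finset.sum_sub_distrib, ← Finset.smul_sum, sum_diagonal_smul, h1]
    exact x_smul_nablaX_vClass_a hw k
  simp only [map_sum, Finset.smul_sum, x_smul_nablaX_smul, h, add_smul, Finset.sum_smul,
    Finset.sum_add_distrib, mul_smul]
  rw [Finset.sum_comm]

/-- On or above the diagonal the shift matrix has at most its corner entry, which carries a factor x
and vanishes at (0, t). The residue is thus lower triangular. -/
theorem evalPoint_logMatrix {t : ℂ} (ht : t ≠ 0) {j k : Fin (mu w)} (h : j ≤ k) :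
    evalPoint t ht (logMatrix w j k) = if j = k then (slope w j : ℂ) else 0 := by
  have h0 : evalPoint t ht (shiftMatrix w j k) = 0 := by
    have h1 : ¬(j : ℕ) = k + 1 := by have := Fin.le_def.1 h; omega
    rw [shiftMatrix, if_neg h1]
    split_ifs
    · rw [map_mul, evalPoint_xR, mul_zero]
    · exact map_zero _
  rw [logMatrix, Matrix.sub_apply, Matrix.smul_apply, map_sub, smul_eq_mul, map_mul, h0, mul_zero,
    sub_zero, Matrix.diagonal_apply]
  split_ifs
  · exact AlgHom.commutes _ _
  · exact map_zero _

theorem residue_eigenvalue (hw : ∀ i, 0 < w i) {t : ℂ} (ht : t ≠ 0) {lam : ℂ} {g : G w}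
    (hg : g ∈ lattice w) (hg' : g ∉ pointIdeal t • lattice w)
    (h : x • nablaX w g - lam • g ∈ pointIdeal t • lattice w) :
    ∃ k < mu w, lam = (slope w k : ℂ) := by
  obtain ⟨r, rfl⟩ := (mem_lattice_iff g).1 hg
  rw [sum_mem_ideal_smul_lattice_iff hw] at hg'
  push Not at hg'
  -- Take the first coordinate of the eigenvector that is nonzero in the fibre. By triangularity,
  -- row j of the eigenvalue equation reads slope · r_j = λ r_j.
  obtain ⟨j, hj, hmin⟩ : ∃ j, r j ∉ pointIdeal t ∧ ∀ k < j, r k ∈ pointIdeal t := by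
    obtain ⟨j, hj, hmin⟩ := WellFounded.has_min (wellFounded_lt (α := Fin (mu w)))
      {k | r k ∉ pointIdeal t} hg'
    exact ⟨j, hj, fun k hk => by_contra fun h => hmin k h hk⟩
  rw [x_smul_nablaX_sum hw, ← algebraMap_smul R lam, Finset.smul_sum, ← Finset.sum_sub_distrib] at h
  simp only [smul_smul, ← sub_smul] at h
  rw [sum_mem_ideal_smul_lattice_iff hw] at h
  have h1 := (mem_pointIdeal_iff ht _).1 (h j)
  have h2 : ∑ k, evalPoint t ht (r k) * evalPoint t ht (logMatrix w j k) =
      evalPoint t ht (r j) * slope w j := by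
    rw [Finset.sum_eq_single j]
    · rw [evalPoint_logMatrix ht le_rfl, if_pos rfl]
    · intro k _ hk
      rcases lt_or_gt_of_ne hk with hlt | hgt
      · rw [(mem_pointIdeal_iff ht _).1 (hmin k hlt), zero_mul]
      · rw [evalPoint_logMatrix ht hgt.le, if_neg hk.symm, mul_zero]
    · simp
  rw [map_sub, map_add, evalPoint_eulerX, zero_add, map_sum, map_mul, AlgHom.commutes] at h1
  simp only [map_mul, h2] at h1
  rw [mem_pointIdeal_iff ht] at hj
  refine ⟨j, j.2, ?_⟩
  change _ - lam * _ = 0 at h1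
  refine mul_right_cancel₀ hj ?_
  linear_combination -h1

theorem isDeligneExtension_lattice (hw : ∀ i, 0 < w i) : IsDeligneExtension w (lattice w) where
  finite := Submodule.fg_span (Set.finite_range _)
  projective := lattice_projective hw
  lattice := exists_pow_smul_mem_lattice hw
  log_x _ := x_smul_nablaX_mem_lattice hw
  log_theta _ := nablaTheta_mem_lattice hw
  residue t ht lam g hg hg' h := by
    obtain ⟨k, hk, rfl⟩ := residue_eigenvalue hw ht hg hg' h
    exact ⟨slope w k, ⟨by exact_mod_cast slope_nonneg k, by exact_mod_cast slope_lt_one hw hk⟩,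
      by simp⟩

end Lattice

end BModel

end

theorem theorem4p2 (n : ℕ) (w : Fin n → ℕ) (hw : ∀ i, 0 < w i) :
    -- the `ω_k` form a basis of `G₀` over `ℂ[x, x⁻¹, θ]`
    (LinearIndependent BModel.A₀ (fun k : Fin (BModel.mu w) => BModel.omega w k) ∧
      Submodule.span BModel.A₀
        (Set.range fun k : Fin (BModel.mu w) => BModel.omega w k) = ⊤) ∧
    -- hence of `G` over `ℂ[x, x⁻¹, θ, θ⁻¹]`
    (LinearIndependent BModel.A
        (fun k : Fin (BModel.mu w) => BModel.toG w (BModel.omega w k)) ∧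
      Submodule.span BModel.A
        (Set.range fun k : Fin (BModel.mu w) => BModel.toG w (BModel.omega w k)) = ⊤) ∧
    -- the matrix of the connection in this basis
    (∀ k : Fin (BModel.mu w),
      BModel.nablaTheta w (BModel.toG w (BModel.omega w k)) =
        ∑ j, BModel.thetaMatrix w j k • BModel.toG w (BModel.omega w j)) ∧
    (∀ k : Fin (BModel.mu w),
      BModel.nablaX w (BModel.toG w (BModel.omega w k)) =
        ∑ j, BModel.xMatrix w j k • BModel.toG w (BModel.omega w j)) ∧
    -- the lattice generated by this basis
    BModel.IsDeligneExtension w (Submodule.span BModel.R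
      (Set.range fun k : Fin (BModel.mu w) => BModel.toG w (BModel.omega w k))) := by
  have h0 : (fun k : Fin (BModel.mu w) => BModel.omega w k) =
      fun k : Fin (BModel.mu w) => BModel.vClass w BModel.A₀ BModel.xA₀ BModel.thetaA₀ 1
        (BModel.a w k) :=
    funext fun k => BModel.omega_eq_vClass w hw k.2
  have h (k : Fin (BModel.mu w)) : BModel.toG w (BModel.omega w k) =
      BModel.vClass w BModel.A BModel.x 1 BModel.tau (BModel.a w k) := by
    rw [congrFun h0 k, BModel.toG_vClass]
  simp only [h, h0]
  exact ⟨⟨BModel.linearIndependent_vClass_A₀ hw, BModel.span_vClass_A₀ hw⟩,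
    ⟨BModel.linearIndependent_vClass_A hw, BModel.span_vClass_A hw⟩,
    BModel.nablaTheta_eq_sum hw, BModel.nablaX_eq_sum hw, BModel.isDeligneExtension_lattice hw⟩
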